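/- Let $\rho(x,y)=(-x,y)$ be the reflection of $\mathbb R^2$ in the axis $\ell=\{0\}\times\mathbb R$. An oriented link diagram $D\subset\mathbb R^2$ is *symmetric* if $\rho(D)$ is obtained from $D$ by reversing the orientation and switching all crossings on $\ell$; it is a *symmetric union* if moreover $\rho$ maps each component of $D$ to itself. Two symmetric diagrams are regarded as identical if an orientation-preserving diffeomorphism of $\mathbb R^2$ that commutes with $\rho$ maps one to the other. Two symmetric diagrams are *weakly symmetrically equivalent* if they are related by a finite sequence of the following moves and their inverses (with all choices of the crossings that are compatible with the symmetry): * a Reidemeister move away from $\ell$ together with its mirror image; * S1($\pm$): removal of a kink whose crossing lies on $\ell$ (the kink being on either side of the strand); * S2(h): two arcs, both crossing $\ell$ perpendicularly, are pushed over one another on $\ell$, so that a mirror-symmetric pair of crossings off $\ell$ appears; * S2(v): removal of two consecutive crossings of opposite type on $\ell$; * S2($\pm$): a crossing on $\ell$ makes half a turn about a horizontal line, removing a mirror-symmetric pair of crossings between its upper and its lower ends; * S3: an arc crossing $\ell$ perpendicularly moves completely over, or completely under, a crossing on $\ell$; * S4: a pair of strands crossing each other on $\ell$ moves completely over, or completely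 under, another pair of strands crossing each other on $\ell$. A symmetric diagram is described by the events met in the half plane $x\ge 0$ from the bottom to the top, its strands being numbered $0,1,2,\dots$ from the axis outwards: $\cup_i$, $\cap_i$ are a local minimum, resp. maximum, off the axis whose legs are the strands $i,i+1$; $\sigma_i^{+}$ ($\sigma_i^{-}$) is a crossing of the strands $i,i+1$ at which the strand going from the lower left to the upper right (from the lower right to the upper left) is over; $\cup$, $\cap$ are a minimum, resp. maximum, on the axis; $\tau^{\pm}$ is a crossing on the axis of the strand $0$ with its mirror image, with the same convention for the over-strand. The left half is the mirror image. Let $$D_4=\cup\;\cup_0\;\sigma_1^+\;\tau^-\;\sigma_0^-\;\tau^+\;\sigma_0^-\;\tau^-\;\sigma_0^-\;\tau^+\;\sigma_1^+\;\sigma_0^-\;\cap_1\;\cap,$$ $$D_4'=\cup\;\cup_1\;\sigma_0^-\;\sigma_0^-\;\tau^+\;\sigma_0^-\;\tau^-\;\sigma_0^-\;\sigma_1^+\;\sigma_0^-\;\cap_1\;\cap,$$ two diagrams of knots, with 16 and 14 crossings, considered by Eisermann and Lamm. **Theorem 1.2.** For each choice of orientations, $D_4$ and $D_4'$ are symmetric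 unions and are Reidemeister equivalent as oriented link diagrams in the plane, but they are not weakly symmetrically equivalent. -/

import Mathlib

/-!
# Symmetric link diagrams and (weak) symmetric equivalence

Oriented link diagrams in the plane are handled as *sliced diagrams* (also called Morse words, or
words in the elementary tangles): after a small isotopy the height function is generic on the
diagram, every horizontal line at a regular height meets the diagram in finitely many upward or
downward strands, and going up the picture one meets one elementary event at a time: a local
minimum, a local maximum, or a crossing.  Two such words describe the same diagram up to
an orientation-preserving diffeomorphism of the plane if and only if they are related by the
relations in `PlanarIsotopy` (these are the codimension-one degenerations of the height function:
two events at the same height, the birth or death of a minimum-maximum pair, and a crossing one of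
whose strands becomes horizontal).

A symmetric diagram is determined by the part of it in the right half plane `x ≥ 0` and by its
crossings on the axis `x = 0`.  It is sliced in the same way, with three more events, on the axis:
a strand crosses the axis perpendicularly in a local minimum or in a local maximum, or two strands
that are mirror images of each other cross on the axis.
-/

namespace SymUnion

/-- An elementary event. Strands are directed: `true` is upward, `false` is downward.
* `min d`: a local minimum; the new left leg has direction `d`, the right leg `!d`;
* `max d`: a local maximum; the left leg below it has direction `d`, the right leg `!d`;
* `cross s`: a crossing of two neighbouring strands; for `s = true` the strand going from the lower
  left to the upper right passes over, for `s = false` the one from the lower right to the upper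
  left does. -/
inductive Elem : Type
  | min (d : Bool)
  | max (d : Bool)
  | cross (s : Bool)
  deriving DecidableEq

namespace Elem

/-- Number of strands entering the event from below. -/
def bot : Elem → ℕ
  | min _ => 0
  | max _ => 2
  | cross _ => 2

/-- Number of strands leaving the event upwards. -/
def top : Elem → ℕ
  | min _ => 2
  | max _ => 0
  | cross _ => 2

/-- Effect on the list (from left to right) of directions of the strands, for an event that takes
place at the left end of the list; `none` if the event is impossible. -/
def act : Elem → List Bool → Option (List Bool)
  | min d, σ => some (d :: (!d) :: σ)
  | max d, a :: b :: σ => if a = d ∧ b = !d then some σ else none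
  | cross _, a :: b :: σ => some (b :: a :: σ)
  | _, _ => none

end Elem

/-- Apply `f` to the part of the list after the first `i` entries. -/
def actAt : ℕ → (List Bool → Option (List Bool)) → List Bool → Option (List Bool)
  | 0, f, σ => f σ
  | i + 1, f, a :: σ => (actAt i f σ).map (a :: ·)
  | _ + 1, _, [] => none

/-- An elementary event with `pos` strands to the left of it. -/
structure Letter : Type where
  pos : ℕ
  elem : Elem
  deriving DecidableEq

/-- Effect of an event on the directions of all strands, listed from left to right. -/
def Letter.act (l : Letter) (σ : List Bool) : Option (List Bool) :=
  actAt l.pos l.elem.act σ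

/-- Directions of the strands above a sequence of events, read from the bottom to the top, that
starts with strands of directions `σ`. -/
def run : List Letter → List Bool → Option (List Bool)
  | [], σ => some σ
  | l :: w, σ => (l.act σ).bind (run w)

/-- An oriented link diagram in the plane: a sequence of events, from the bottom to the top, with
no strands below and none above. -/
structure Diagram : Type where
  word : List Letter
  closed : run word [] = some []

/-- `u` and `v` differ by one replacement of a consecutive piece `x` by `y` with `M x y`. -/
def Rewrites {α : Type} (M : List α → List α → Prop) (u v : List α) : Prop :=
  ∃ a b x y : List α, M x y ∧ u = a ++ x ++ b ∧ v = a ++ y ++ b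

/-- Relations for planar isotopy. -/
inductive PlanarIsotopy : List Letter → List Letter → Prop
  /-- two distant events change their heights; `x` is on the left -/
  | far (i k : ℕ) (x y : Elem) : PlanarIsotopy
      [⟨i, x⟩, ⟨i + x.top + k, y⟩] [⟨i + x.bot + k, y⟩, ⟨i, x⟩]
  /-- a maximum and a minimum cancel -/
  | zigzag (i : ℕ) (d : Bool) : PlanarIsotopy [⟨i, .min d⟩, ⟨i + 1, .max (!d)⟩] []
  | zagzig (i : ℕ) (d : Bool) : PlanarIsotopy [⟨i + 1, .min d⟩, ⟨i, .max (!d)⟩] []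
  /-- a crossing moves over a maximum, from one of its legs to the other -/
  | slideMax (i : ℕ) (s d : Bool) : PlanarIsotopy
      [⟨i + 1, .cross s⟩, ⟨i, .max d⟩] [⟨i, .cross (!s)⟩, ⟨i + 1, .max d⟩]
  /-- a crossing moves through a minimum, from one of its legs to the other -/
  | slideMin (i : ℕ) (s d : Bool) : PlanarIsotopy
      [⟨i, .min d⟩, ⟨i + 1, .cross s⟩] [⟨i + 1, .min d⟩, ⟨i, .cross (!s)⟩]

/-- The Reidemeister moves. -/
inductive Reidemeister : List Letter → List Letter → Prop
  | r1Min (i : ℕ) (d s : Bool) : Reidemeister [⟨i, .min d⟩, ⟨i, .cross s⟩] [⟨i, .min (!d)⟩]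
  | r1Max (i : ℕ) (d s : Bool) : Reidemeister [⟨i, .cross s⟩, ⟨i, .max (!d)⟩] [⟨i, .max d⟩]
  | r2 (i : ℕ) (s : Bool) : Reidemeister [⟨i, .cross s⟩, ⟨i, .cross (!s)⟩] []
  /-- The hypothesis says that one of the three strands is on the top and one at the bottom. -/
  | r3 (i : ℕ) (a b c : Bool) (h : a = c → b = a) : Reidemeister
      [⟨i, .cross a⟩, ⟨i + 1, .cross b⟩, ⟨i, .cross c⟩]
      [⟨i + 1, .cross c⟩, ⟨i, .cross b⟩, ⟨i + 1, .cross a⟩]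

/-- Reidemeister equivalence of oriented link diagrams in the plane. -/
def ReidemeisterEquivalent : Diagram → Diagram → Prop :=
  Relation.EqvGen fun D E =>
    Rewrites PlanarIsotopy D.word E.word ∨ Rewrites Reidemeister D.word E.word

/-! ### Symmetric diagrams -/

/-- An event on the axis. The directions are those of the strand in the right half plane that is
next to the axis.
* `min d`: a strand crosses the axis in a local minimum, its right leg has direction `d`;
* `max d`: a strand crosses the axis in a local maximum, its right leg has direction `d`;
* `cross s`: the strand next to the axis and its mirror image cross on the axis; for `s = true` the
  strand going from the lower left to the upper right passes over. -/
inductive AxisElem : Type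
  | min (d : Bool)
  | max (d : Bool)
  | cross (s : Bool)
  deriving DecidableEq

namespace AxisElem

/-- Number of strands in the right half plane entering the event from below. -/
def bot : AxisElem → ℕ
  | min _ => 0
  | max _ => 1
  | cross _ => 1

/-- Number of strands in the right half plane leaving the event upwards. -/
def top : AxisElem → ℕ
  | min _ => 1
  | max _ => 0
  | cross _ => 1

/-- Effect on the directions of the strands in the right half plane, listed from the axis outwards.
The mirror image of a strand, with the reversed orientation, has the opposite vertical direction;
so does the strand that emerges from a crossing on the axis. -/
def act : AxisElem → List Bool → Option (List Bool)
  | min d, σ => some (d :: σ)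
  | max d, a :: σ => if a = d then some σ else none
  | cross _, a :: σ => some ((!a) :: σ)
  | _, [] => none

end AxisElem

/-- An event of a symmetric diagram: either an event in the open right half plane, with `pos`
strands between it and the axis, together with its mirror image, or an event on the axis. -/
inductive SLetter : Type
  | off (l : Letter)
  | axis (x : AxisElem)
  deriving DecidableEq

/-- Effect on the directions of the strands in the right half plane, listed from the axis
outwards. -/
def SLetter.act : SLetter → List Bool → Option (List Bool)
  | off l, σ => l.act σ
  | axis x, σ => x.act σ

/-- Directions of the strands in the right half plane above a sequence of events. -/
def srun : List SLetter → List Bool → Option (List Bool)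
  | [], σ => some σ
  | l :: w, σ => (l.act σ).bind (srun w)

/-- An oriented symmetric diagram: it is carried by the reflection in the axis to the diagram
obtained by reversing all orientations and switching the crossings on the axis. -/
structure SymDiagram : Type where
  word : List SLetter
  closed : srun word [] = some []

/-- The events in the whole plane that make up an event of a symmetric diagram with `n` strands in
each half plane. Reflection keeps the over-strand of a crossing off the axis, and it exchanges the
two diagonals. -/
def SLetter.unfold (n : ℕ) : SLetter → List Letter
  | off ⟨i, .min d⟩ => [⟨n + i, .min d⟩, ⟨n - i, .min d⟩]
  | off ⟨i, .max d⟩ => [⟨n + i, .max d⟩, ⟨n - (i + 2), .max d⟩]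
  | off ⟨i, .cross s⟩ => [⟨n + i, .cross s⟩, ⟨n - (i + 2), .cross (!s)⟩]
  | axis (.min d) => [⟨n, .min (!d)⟩]
  | axis (.max d) => [⟨n - 1, .max (!d)⟩]
  | axis (.cross s) => [⟨n - 1, .cross s⟩]

/-- The events in the whole plane of a sequence of events that starts with strands of directions
`σ` in the right half plane. -/
def unfold : List SLetter → List Bool → List Letter
  | [], _ => []
  | l :: w, σ => l.unfold σ.length ++ unfold w ((l.act σ).getD [])

/-- Directions, from left to right, of the strands on both sides of the axis, from those on the
right side. -/
def double (σ : List Bool) : List Bool := (σ.map (!·)).reverse ++ σ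

theorem actAt_append (a σ : List Bool) (i : ℕ) (f : List Bool → Option (List Bool)) :
    actAt (a.length + i) f (a ++ σ) = (actAt i f σ).map (a ++ ·) := by
  induction a with
  | nil => simp
  | cons x a ih =>
    have h : (x :: a).length + i = (a.length + i) + 1 := by simp; omega
    rw [h, List.cons_append]
    simp only [actAt, ih, Option.map_map]
    rfl

theorem actAt_length (a σ : List Bool) (f : List Bool → Option (List Bool)) :
    actAt a.length f (a ++ σ) = (f σ).map (a ++ ·) := by
  simpa [actAt] using actAt_append a σ 0 f

theorem exists_of_actAt {i : ℕ} {f : List Bool → Option (List Bool)} {σ τ : List Bool}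
    (h : actAt i f σ = some τ) :
    ∃ a b c, a.length = i ∧ σ = a ++ b ∧ f b = some c ∧ τ = a ++ c := by
  induction i generalizing σ τ with
  | zero => exact ⟨[], σ, τ, rfl, rfl, h, rfl⟩
  | succ i ih =>
    cases σ with
    | nil => simp [actAt] at h
    | cons x σ =>
      simp only [actAt, Option.map_eq_some_iff] at h
      obtain ⟨ρ, hρ, rfl⟩ := h
      obtain ⟨a, b, c, h1, h2, h3, h4⟩ := ih hρ
      exact ⟨x :: a, b, c, by simp [h1], by simp [h2], h3, by simp [h4]⟩

theorem run_append (u v : List Letter) (σ : List Bool) :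
    run (u ++ v) σ = (run u σ).bind (run v) := by
  induction u generalizing σ with
  | nil => rfl
  | cons l u ih => simp [run, Option.bind_assoc, ih]

theorem act_of_eq {i : ℕ} {x : Elem} (a b c : List Bool) (h : a.length = i)
    (hb : x.act b = some c) : (⟨i, x⟩ : Letter).act (a ++ b) = some (a ++ c) := by
  subst h
  simp [Letter.act, actAt_length, hb]

theorem run_unfold_letter {l : SLetter} {σ τ : List Bool} (h : l.act σ = some τ) :
    run (l.unfold σ.length) (double σ) = some (double τ) := by
  cases l with
  | off l =>
    obtain ⟨i, x⟩ := l
    obtain ⟨a, b, c, h1, rfl, h3, rfl⟩ := exists_of_actAt h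
    change a.length = i at h1
    change x.act b = some c at h3
    simp only [double]
    cases x with
    | min d =>
      simp only [Elem.act, Option.some.injEq] at h3
      subst h3
      have e1 := act_of_eq (i := (a ++ b).length + i) (x := .min d)
        (((a ++ b).map (!·)).reverse ++ a) b (d :: (!d) :: b) (by simp; omega) rfl
      have e2 := act_of_eq (i := (a ++ b).length - i) (x := .min d)
        ((b.map (!·)).reverse) ((a.map (!·)).reverse ++ (a ++ d :: (!d) :: b)) _
        (by simp; omega) rfl
      simp only [SLetter.unfold, run]
      simp only [List.append_assoc, List.map_append, List.reverse_append] at e1 e2 ⊢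
      rw [e1, Option.bind_some, e2]
      simp
    | max d =>
      match b, h3 with
      | p :: q :: b, h3 =>
        simp only [Elem.act] at h3
        split_ifs at h3 with hc
        simp only [Option.some.injEq] at h3
        subst h3
        obtain ⟨rfl, rfl⟩ := hc
        have e1 := act_of_eq (i := (a ++ p :: (!p) :: b).length + i) (x := .max p)
          (((a ++ p :: (!p) :: b).map (!·)).reverse ++ a) (p :: (!p) :: b) b (by simp; omega)
          (by simp [Elem.act])
        have e2 := act_of_eq (i := (a ++ p :: (!p) :: b).length - (i + 2)) (x := .max p)
          ((b.map (!·)).reverse) (p :: (!p) :: ((a.map (!·)).reverse ++ (a ++ b)))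
          ((a.map (!·)).reverse ++ (a ++ b)) (by simp; omega) (by simp [Elem.act])
        simp only [SLetter.unfold, run]
        simp only [List.append_assoc, List.map_append, List.reverse_append, List.map_cons,
          List.reverse_cons, Bool.not_not, List.cons_append, List.nil_append] at e1 e2 ⊢
        rw [e1, Option.bind_some, e2]
        simp
    | cross s =>
      match b, h3 with
      | p :: q :: b, h3 =>
        simp only [Elem.act, Option.some.injEq] at h3
        subst h3
        have e1 := act_of_eq (i := (a ++ p :: q :: b).length + i) (x := .cross s)
          (((a ++ p :: q :: b).map (!·)).reverse ++ a) (p :: q :: b) (q :: p :: b)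
          (by simp; omega) rfl
        have e2 := act_of_eq (i := (a ++ p :: q :: b).length - (i + 2)) (x := .cross (!s))
          ((b.map (!·)).reverse)
          ((!q) :: (!p) :: ((a.map (!·)).reverse ++ (a ++ q :: p :: b)))
          ((!p) :: (!q) :: ((a.map (!·)).reverse ++ (a ++ q :: p :: b))) (by simp; omega) rfl
        simp only [SLetter.unfold, run]
        simp only [List.append_assoc, List.map_append, List.reverse_append, List.map_cons,
          List.reverse_cons, List.cons_append, List.nil_append] at e1 e2 ⊢
        rw [e1, Option.bind_some, e2]
        simp
  | axis x =>
    cases x with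
    | min d =>
      simp only [SLetter.act, AxisElem.act, Option.some.injEq] at h
      subst h
      have e := act_of_eq (i := σ.length) (x := .min (!d)) ((σ.map (!·)).reverse) σ
        ((!d) :: d :: σ) (by simp) (by simp [Elem.act])
      simp [SLetter.unfold, run, double, e]
    | max d =>
      match σ, h with
      | a :: σ, h =>
        simp only [SLetter.act, AxisElem.act] at h
        split_ifs at h with hc
        simp only [Option.some.injEq] at h
        subst h hc
        have e := act_of_eq (i := σ.length) (x := .max (!a)) ((σ.map (!·)).reverse)
          ((!a) :: a :: σ) σ (by simp) (by simp [Elem.act])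
        simp [SLetter.unfold, run, double, e]
    | cross s =>
      match σ, h with
      | a :: σ, h =>
        simp only [SLetter.act, AxisElem.act, Option.some.injEq] at h
        subst h
        have e := act_of_eq (i := σ.length) (x := .cross s) ((σ.map (!·)).reverse)
          ((!a) :: a :: σ) (a :: (!a) :: σ) (by simp) rfl
        simp [SLetter.unfold, run, double, e]

theorem run_unfold (w : List SLetter) {σ τ : List Bool} (h : srun w σ = some τ) :
    run (unfold w σ) (double σ) = some (double τ) := by
  induction w generalizing σ with
  | nil => simp only [srun, Option.some.injEq] at h; subst h; rfl
  | cons l w ih =>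
    simp only [srun, Option.bind_eq_some_iff] at h
    obtain ⟨ρ, h1, h2⟩ := h
    simp only [unfold, run_append, run_unfold_letter h1, Option.bind_some, h1, Option.getD_some]
    exact ih h2

/-- The oriented link diagram in the plane underlying a symmetric diagram. -/
def SymDiagram.toDiagram (D : SymDiagram) : Diagram where
  word := unfold D.word []
  closed := run_unfold D.word D.closed

/-- A point of a symmetric diagram at a regular height: it lies above exactly `level` events, it is
the strand number `pos` (counted from `0`, from the axis outwards) on the right side of the axis if
`right = true` and on the left side otherwise. -/
structure Point : Type where
  level : ℕ
  pos : ℕ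
  right : Bool

/-- Two points that are joined by an arc of the diagram which passes at most one event. -/
inductive Joined (w : List SLetter) : Point → Point → Prop
  | below (k i j : ℕ) (x : Elem) (r : Bool) (h : w[k]? = some (.off ⟨i, x⟩)) (hj : j < i) :
      Joined w ⟨k, j, r⟩ ⟨k + 1, j, r⟩
  | beyond (k i j : ℕ) (x : Elem) (r : Bool) (h : w[k]? = some (.off ⟨i, x⟩)) :
      Joined w ⟨k, i + x.bot + j, r⟩ ⟨k + 1, i + x.top + j, r⟩
  | min (k i : ℕ) (d r : Bool) (h : w[k]? = some (.off ⟨i, .min d⟩)) :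
      Joined w ⟨k + 1, i, r⟩ ⟨k + 1, i + 1, r⟩
  | max (k i : ℕ) (d r : Bool) (h : w[k]? = some (.off ⟨i, .max d⟩)) :
      Joined w ⟨k, i, r⟩ ⟨k, i + 1, r⟩
  | crossOut (k i : ℕ) (s r : Bool) (h : w[k]? = some (.off ⟨i, .cross s⟩)) :
      Joined w ⟨k, i, r⟩ ⟨k + 1, i + 1, r⟩
  | crossIn (k i : ℕ) (s r : Bool) (h : w[k]? = some (.off ⟨i, .cross s⟩)) :
      Joined w ⟨k, i + 1, r⟩ ⟨k + 1, i, r⟩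
  | axisBeyond (k j : ℕ) (x : AxisElem) (r : Bool) (h : w[k]? = some (.axis x)) :
      Joined w ⟨k, x.bot + j, r⟩ ⟨k + 1, x.top + j, r⟩
  | axisMin (k : ℕ) (d : Bool) (h : w[k]? = some (.axis (.min d))) :
      Joined w ⟨k + 1, 0, false⟩ ⟨k + 1, 0, true⟩
  | axisMax (k : ℕ) (d : Bool) (h : w[k]? = some (.axis (.max d))) :
      Joined w ⟨k, 0, false⟩ ⟨k, 0, true⟩
  | axisCross (k : ℕ) (s r : Bool) (h : w[k]? = some (.axis (.cross s))) :
      Joined w ⟨k, 0, r⟩ ⟨k + 1, 0, !r⟩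

/-- A symmetric diagram is a symmetric union if the reflection in the axis maps every component to
itself, that is, every point lies on the same component as its mirror image. (The reflection
reverses the orientation of a symmetric diagram, hence of each of these components.) -/
def SymDiagram.IsSymmetricUnion (D : SymDiagram) : Prop :=
  ∀ (k i : ℕ) (σ : List Bool), srun (D.word.take k) [] = some σ → i < σ.length →
    Relation.EqvGen (Joined D.word) ⟨k, i, true⟩ ⟨k, i, false⟩

/-- Relations for isotopies of the plane that commute with the reflection in the axis. Besides an
isotopy off the axis, carried out together with its mirror image, they are the exchange of an event
on the axis with one far from the axis, and the change of a maximum on the axis to a minimum (or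
vice versa) by which a symmetric pair of maxima (or minima) off the axis is born. -/
inductive SymIsotopy : List SLetter → List SLetter → Prop
  | off {u v : List Letter} (h : PlanarIsotopy u v) : SymIsotopy (u.map .off) (v.map .off)
  | far (k : ℕ) (x : AxisElem) (y : Elem) : SymIsotopy
      [.axis x, .off ⟨x.top + k, y⟩] [.off ⟨x.bot + k, y⟩, .axis x]
  | axisMax (d : Bool) : SymIsotopy [.axis (.min d), .off ⟨0, .max d⟩] [.axis (.max (!d))]
  | axisMin (d : Bool) : SymIsotopy [.off ⟨0, .min d⟩, .axis (.max d)] [.axis (.min (!d))]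

/-- The rotation by `π` of an event of a symmetric diagram. -/
def SLetter.rotate : SLetter → SLetter
  | off ⟨i, .min d⟩ => off ⟨i, .max d⟩
  | off ⟨i, .max d⟩ => off ⟨i, .min d⟩
  | off ⟨i, .cross s⟩ => off ⟨i, .cross (!s)⟩
  | axis (.min d) => axis (.max d)
  | axis (.max d) => axis (.min d)
  | axis (.cross s) => axis (.cross s)

/-- The rotation of the plane by `π` about a point of the axis, applied to a symmetric diagram. It
commutes with the reflection, preserves the orientation of the plane, and exchanges the two half
planes. -/
def rotate (w : List SLetter) : List SLetter := (w.map SLetter.rotate).reverse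

/-- Symmetric Reidemeister moves: those off the axis (a Reidemeister move together with its mirror
image), and the moves S2(h), S2(±), S3 and S4 on the axis. -/
inductive SymReidemeister : List SLetter → List SLetter → Prop
  | off {u v : List Letter} (h : Reidemeister u v) : SymReidemeister (u.map .off) (v.map .off)
  /-- S2(h): two arcs crossing the axis perpendicularly, one above the other, are pushed over each
  other on the axis; two mirror-symmetric crossings off the axis appear. -/
  | s2h (d e s : Bool) : SymReidemeister
      [.axis (.min d), .off ⟨0, .cross s⟩, .axis (.max e)] [.axis (.max e), .axis (.min d)]
  /-- S2(±): a crossing on the axis makes half a turn about a horizontal line; the two crossings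
  off the axis between its upper and its lower ends disappear. -/
  | s2 (d e s t : Bool) : SymReidemeister
      [.off ⟨0, .min d⟩, .axis (.cross t), .off ⟨1, .cross s⟩, .off ⟨0, .max e⟩]
      [.axis (.cross t)]
  /-- S3: an arc crossing the axis perpendicularly moves over or under a crossing on the axis. -/
  | s3 (d s t : Bool) : SymReidemeister
      [.axis (.min d), .off ⟨0, .cross s⟩, .axis (.cross t)]
      [.axis (.cross t), .axis (.min d), .off ⟨0, .cross s⟩]
  | s3Max (d s t : Bool) : SymReidemeister
      [.off ⟨0, .cross s⟩, .axis (.max d), .axis (.cross t)]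
      [.axis (.cross t), .off ⟨0, .cross s⟩, .axis (.max d)]
  /-- S4: two strands crossing on the axis move over or under two other strands crossing on the
  axis. -/
  | s4 (d e s m n : Bool) : SymReidemeister
      [.off ⟨0, .min d⟩, .axis (.cross n),
        .off ⟨1, .cross s⟩, .off ⟨0, .cross s⟩, .off ⟨2, .cross s⟩, .off ⟨1, .cross s⟩,
        .axis (.cross m), .off ⟨0, .max e⟩]
      [.axis (.cross m), .off ⟨0, .max e⟩, .off ⟨0, .min d⟩, .axis (.cross n)]

/-- The moves S1(±): a kink with its crossing on the axis disappears. -/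
inductive S1Move : List SLetter → List SLetter → Prop
  | max (d s : Bool) : S1Move [.axis (.cross s), .axis (.max (!d))] [.axis (.max d)]
  | min (d s : Bool) : S1Move [.axis (.min d), .axis (.cross s)] [.axis (.min (!d))]

/-- The move S2(v): two consecutive opposite crossings on the axis disappear. -/
inductive S2vMove : List SLetter → List SLetter → Prop
  | mk (s : Bool) : S2vMove [.axis (.cross s), .axis (.cross (!s))] []

/-- Two symmetric diagrams represent identical diagrams, or differ by one symmetric Reidemeister
move, one S1-move or one S2(v)-move. -/
def WeakStep (D E : SymDiagram) : Prop :=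
  Rewrites SymIsotopy D.word E.word ∨ E.word = rotate D.word ∨
    Rewrites SymReidemeister D.word E.word ∨ Rewrites S1Move D.word E.word ∨
      Rewrites S2vMove D.word E.word

/-- Weak symmetric equivalence of oriented symmetric diagrams. -/
def WeaklySymmetricallyEquivalent : SymDiagram → SymDiagram → Prop :=
  Relation.EqvGen WeakStep

/-- The diagram `D₄` of Eisermann and Lamm, with one of its two orientations. -/
def D4 (d : Bool) : SymDiagram where
  word := [.axis (.min d), .off ⟨0, .min (!d)⟩, .off ⟨1, .cross true⟩, .axis (.cross false),
    .off ⟨0, .cross false⟩, .axis (.cross true), .off ⟨0, .cross false⟩, .axis (.cross false),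
    .off ⟨0, .cross false⟩, .axis (.cross true), .off ⟨1, .cross true⟩, .off ⟨0, .cross false⟩,
    .off ⟨1, .max d⟩, .axis (.max d)]
  closed := by cases d <;> decide

/-- The diagram `D'₄` of Eisermann and Lamm, with one of its two orientations. -/
def D4' (d : Bool) : SymDiagram where
  word := [.axis (.min d), .off ⟨1, .min (!d)⟩, .off ⟨0, .cross false⟩, .off ⟨0, .cross false⟩,
    .axis (.cross true), .off ⟨0, .cross false⟩, .axis (.cross false), .off ⟨0, .cross false⟩,
    .off ⟨1, .cross true⟩, .off ⟨0, .cross false⟩, .off ⟨1, .max (!d)⟩, .axis (.max d)]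
  closed := by cases d <;> decide

end SymUnion

/-! The obstruction to weak symmetric equivalence is a count of colourings. Replace every crossing
on the axis by a full twist of its two strands, in a sense that depends on the type of the crossing.
The symmetric moves become isotopies of the resulting link: a full twist closed off by an arc comes
undone (S1), opposite twists cancel (S2(v)), a twist is unchanged by half a turn about a horizontal
line (S2(±)), and arcs or pairs of strands slide over or under it (S3, S4). So the number of
labellings of this link, by the Wirtinger rule, with elements of a conjugacy class closed under
inversion is an invariant.

The link itself is never built. Each event is a transition between pairs of rows of colours, one row
per half plane, and a word is a composition of transitions; multisets keep track of multiplicities.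
The left row records inverse colours, so that an event off the axis acts on both rows by the same
rule. A full twist conjugates the two innermost colours `a`, `b` by `a⁻¹b` or by `b⁻¹a`, and hence
preserves `b⁻¹a`; this is what makes the moves on the axis work. Invariance is checked on the pieces
that a move replaces (`scolorRun_eq_of_symIsotopy`, `scolorRun_eq_of_symReidemeister`,
`scolorRun_eq_of_s1Move`, `scolorRun_eq_of_s2vMove`). The rotation by π transposes all transitions
(`count_scolorRun_rotate`). Together these give `WeaklySymmetricallyEquivalent.colorings_eq`. With
the twenty three-cycles of the alternating group on five letters, the two diagrams have 140 and 20
colourings (`colorings_D4`, `colorings_D4'`), whatever their orientations.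

The positive claims rest on explicit certificates. A walk along the whole knot shows that each
diagram has one component, which reflection must preserve (`isSymmetricUnion_of_tests`). Recorded
sequences of moves take both diagrams to a common one (`reidemeisterEquivalent_of_codedMoves`). -/

namespace SymUnion

/-! ### Symmetric quandles -/

/-- A symmetric quandle: a quandle with a compatible involution, like a conjugacy class of a group
that is closed under inversion. -/
class SymQuandle (Q : Type) where
  act : Q → Q → Q
  inv : Q → Q
  involutive (a : Q) : inv (inv a) = a
  act_self (a : Q) : act a a = a
  act_inv (a b : Q) : act a (inv b) = inv (act a b)
  inv_act_act (a b : Q) : act (inv a) (act a b) = b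
  act_act (a b c : Q) : act (act a b) c = act a (act b (act (inv a) c))

infixr:80 " ▷ " => SymQuandle.act

open SymQuandle

namespace SymQuandle

attribute [simp] involutive act_self act_inv inv_act_act act_act

variable {Q : Type} [SymQuandle Q]

@[simp] theorem act_inv_act (a b : Q) : a ▷ inv a ▷ b = b := by
  simpa using inv_act_act (inv a) b

@[simp] theorem inv_act_self (a : Q) : inv a ▷ a = a := by
  have h := inv_act_act a a
  rwa [act_self] at h

@[simp] theorem inv_act_inj {a b : Q} : inv a = inv b ↔ a = b :=
  ⟨fun h => by rw [← involutive a, h, involutive], fun h => by rw [h]⟩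

@[simp] theorem act_inj {a b c : Q} : a ▷ b = a ▷ c ↔ b = c :=
  ⟨fun h => by rw [← inv_act_act a b, h, inv_act_act], fun h => by rw [h]⟩

theorem eq_inv_comm {a b : Q} : a = inv b ↔ b = inv a := by
  rw [← inv_act_inj, involutive, eq_comm]

theorem act_eq_iff {a b c : Q} : a ▷ b = c ↔ b = inv a ▷ c := by
  rw [← act_inj (a := inv a), inv_act_act]

/-- The action of the inverse of `a ▷ b`. -/
@[simp] theorem inv_act_act' (a b c : Q) : inv (a ▷ b) ▷ c = a ▷ inv b ▷ inv a ▷ c := by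
  rw [← act_inv, act_act]

/-- The involution as a permutation. -/
def invEquiv : Q ≃ Q := ⟨inv, inv, involutive, involutive⟩

/-- The action of an element as a permutation. -/
def actEquiv (a : Q) : Q ≃ Q := ⟨(a ▷ ·), (inv a ▷ ·), inv_act_act a, act_inv_act a⟩

end SymQuandle

/-! ### Sums over all colours, as multisets -/

section Multiset

variable {α β γ : Type}

/-- A minimum sums over all colours of its legs, and a maximum that meets one of the legs leaves a
single colour. -/
theorem bind_ite_eq [Fintype α] [DecidableEq α] (c : α) (g : α → Multiset β) :
    ((Finset.univ : Finset α).val.bind fun a => if a = c then g a else 0) = g c := by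
  have : ((Finset.univ : Finset α).val.bind fun a => if a = c then g a else 0) =
      ∑ a : α, if a = c then g a else 0 := rfl
  rw [this, Finset.sum_ite_eq']
  simp

/-- Reindexes the colour born at a minimum when the two sides of a move name it differently, by
inversion or by conjugation. -/
theorem map_univ_equiv [Fintype α] (e : α ≃ α) (g : α → β) :
    (Finset.univ : Finset α).val.map (fun a => g (e a)) = (Finset.univ : Finset α).val.map g := by
  conv_rhs => rw [← Multiset.map_univ_val_equiv e, Multiset.map_map]
  rfl

@[simp] theorem ite_zero_bind (p : Prop) [Decidable p] (s : Multiset α) (g : α → Multiset β) :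
    (if p then s else 0).bind g = if p then s.bind g else 0 := by
  split <;> simp

@[simp] theorem map_ite_zero (p : Prop) [Decidable p] (s : Multiset α) (g : α → β) :
    (if p then s else 0).map g = if p then s.map g else 0 := by
  split <;> simp

/-- A double sum over all pairs that satisfy a condition with a unique solution. -/
theorem bind_bind_ite_eq [Fintype α] [DecidableEq α] {p q : α → α → Prop}
    [∀ a b, Decidable (p a b)] [∀ a b, Decidable (q a b)] (c d : α)
    (h : ∀ a b, p a b ∧ q a b ↔ a = c ∧ b = d) (g : α → α → Multiset β) :
    ((Finset.univ : Finset α).val.bind fun a => (Finset.univ : Finset α).val.bind fun b =>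
      if p a b then if q a b then g a b else 0 else 0) = g c d := by
  simp only [← ite_and, h]
  simp only [ite_and]
  rw [← bind_ite_eq c fun a => g a d]
  refine Multiset.bind_congr fun a _ => ?_
  split_ifs
  · exact bind_ite_eq d (g a)
  · simp

@[simp] theorem ite_zero_product_ite_zero (p q : Prop) [Decidable p] [Decidable q] (s : Multiset α)
    (t : Multiset β) :
    ((if p then s else 0) ×ˢ if q then t else 0) = if p then if q then s ×ˢ t else 0 else 0 := by
  split_ifs <;> simp

@[simp] theorem bind_ite_zero (p : Prop) [Decidable p] (s : Multiset α) (g : α → Multiset β) :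
    (s.bind fun a => if p then g a else 0) = if p then s.bind g else 0 := by
  split <;> simp

end Multiset

/-! ### Colourings of words of events in the plane -/

section ColorAt

variable {α : Type}

/-- Apply `f` to the part of the list after the first `i` entries. -/
def colorAt : ℕ → (List α → Multiset (List α)) → List α → Multiset (List α)
  | 0, f, σ => f σ
  | i + 1, f, a :: σ => (colorAt i f σ).map (a :: ·)
  | _ + 1, _, [] => 0

theorem colorAt_append (a σ : List α) (i : ℕ) (f : List α → Multiset (List α)) :
    colorAt (a.length + i) f (a ++ σ) = (colorAt i f σ).map (a ++ ·) := by
  induction a with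
  | nil => simp
  | cons x a ih =>
    have h : (x :: a).length + i = (a.length + i) + 1 := by simp; omega
    rw [h, List.cons_append, colorAt, ih, Multiset.map_map]
    rfl

theorem colorAt_eq_zero {i : ℕ} {f : List α → Multiset (List α)} {σ : List α}
    (h : σ.length < i) : colorAt i f σ = 0 := by
  induction i generalizing σ with
  | zero => simp at h
  | succ i ih =>
    cases σ with
    | nil => rfl
    | cons a σ => rw [colorAt, ih (by simpa using h), Multiset.map_zero]

end ColorAt

section Coloring

variable {Q : Type} [SymQuandle Q] [Fintype Q] [DecidableEq Q]

/-- The colours of the strands above an event that takes place at the left end of a row of strands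
with colours `σ`. -/
def Elem.color : Elem → List Q → Multiset (List Q)
  | min _, σ => (Finset.univ : Finset Q).val.map fun a => a :: inv a :: σ
  | max _, a :: b :: σ => if b = inv a then {σ} else 0
  | cross true, a :: b :: σ => {(a ▷ b) :: a :: σ}
  | cross false, a :: b :: σ => {b :: (inv b ▷ a) :: σ}
  | _, _ => 0

def Letter.color (l : Letter) (σ : List Q) : Multiset (List Q) := colorAt l.pos l.elem.color σ

@[simp] theorem Letter.color_zero (x : Elem) (σ : List Q) : (⟨0, x⟩ : Letter).color σ = x.color σ := rfl

@[simp] theorem Letter.color_succ (i : ℕ) (x : Elem) (a : Q) (σ : List Q) :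
    (⟨i + 1, x⟩ : Letter).color (a :: σ) = ((⟨i, x⟩ : Letter).color σ).map (a :: ·) := rfl

@[simp] theorem Elem.color_min (d : Bool) (σ : List Q) :
    (Elem.min d).color σ = (Finset.univ : Finset Q).val.map fun a => a :: inv a :: σ := rfl

@[simp] theorem Elem.color_max (d : Bool) (a b : Q) (σ : List Q) :
    (Elem.max d).color (a :: b :: σ) = if b = inv a then {σ} else 0 := rfl

@[simp] theorem Elem.color_cross_true (a b : Q) (σ : List Q) :
    (Elem.cross true).color (a :: b :: σ) = {(a ▷ b) :: a :: σ} := rfl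

@[simp] theorem Elem.color_cross_false (a b : Q) (σ : List Q) :
    (Elem.cross false).color (a :: b :: σ) = {b :: (inv b ▷ a) :: σ} := rfl

/-- The colours of the strands above a sequence of events, with multiplicities. -/
def colorRun : List Letter → List Q → Multiset (List Q)
  | [], σ => {σ}
  | l :: w, σ => (l.color σ).bind (colorRun w)

@[simp] theorem colorRun_nil (σ : List Q) : colorRun [] σ = {σ} := rfl

theorem colorRun_singleton (l : Letter) (σ : List Q) : colorRun [l] σ = l.color σ := by
  exact (Multiset.bind_singleton (l.color σ) fun τ => τ).trans (Multiset.map_id' _)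

theorem colorRun_pair (l m : Letter) (σ : List Q) :
    colorRun [l, m] σ = (l.color σ).bind m.color :=
  Multiset.bind_congr fun τ _ => colorRun_singleton m τ

@[simp] theorem colorRun_cons (l : Letter) (w : List Letter) (σ : List Q) :
    colorRun (l :: w) σ = (l.color σ).bind fun τ => colorRun w τ := rfl

/-- The event with `i` more strands to the left. -/
def Letter.shift (i : ℕ) (l : Letter) : Letter := ⟨i + l.pos, l.elem⟩

theorem colorRun_shift (w : List Letter) (a σ : List Q) :
    colorRun (w.map (Letter.shift a.length)) (a ++ σ) = (colorRun w σ).map (a ++ ·) := by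
  induction w generalizing σ with
  | nil => simp [colorRun]
  | cons l w ih =>
    simp only [List.map_cons, colorRun, Letter.color, Letter.shift, colorAt_append,
      Multiset.bind_map, Multiset.map_bind]
    exact Multiset.bind_congr fun _ _ => ih _

theorem Elem.color_append (x : Elem) (b r : List Q) (h : b.length = x.bot) :
    x.color (b ++ r) = (x.color b).map (· ++ r) := by
  match x, b, h with
  | .min _, [], _ => simp [Elem.color]
  | .max _, [p, q], _ =>
    simp only [List.cons_append, List.nil_append, Elem.color]
    split <;> simp
  | .cross true, [p, q], _ => simp [Elem.color]
  | .cross false, [p, q], _ => simp [Elem.color]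

theorem Elem.color_of_lt (x : Elem) (b : List Q) (h : b.length < x.bot) : x.color b = 0 := by
  match x, b, h with
  | .max _, [p], _ => rfl
  | .cross true, [p], _ => rfl
  | .cross false, [p], _ => rfl
  | .max _, [], _ => rfl
  | .cross true, [], _ => rfl
  | .cross false, [], _ => rfl

theorem Elem.length_of_mem_color (x : Elem) {b c : List Q} (h : c ∈ x.color b) :
    c.length + x.bot = b.length + x.top := by
  match x, b, h with
  | .min _, b, h =>
    simp only [Elem.color, Multiset.mem_map] at h
    obtain ⟨a, -, rfl⟩ := h
    simp [Elem.bot, Elem.top]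
  | .max _, p :: q :: b, h =>
    simp only [Elem.color] at h
    split at h <;> simp_all [Elem.bot, Elem.top]
  | .cross true, p :: q :: b, h => simp_all [Elem.color, Elem.bot, Elem.top]
  | .cross false, p :: q :: b, h => simp_all [Elem.color, Elem.bot, Elem.top]
  | .max _, [p], h => simp [Elem.color] at h
  | .cross true, [p], h => simp [Elem.color] at h
  | .cross false, [p], h => simp [Elem.color] at h
  | .max _, [], h => simp [Elem.color] at h
  | .cross true, [], h => simp [Elem.color] at h
  | .cross false, [], h => simp [Elem.color] at h

theorem length_of_mem_colorAt {i : ℕ} {x : Elem} {b c : List Q} (h : c ∈ colorAt i x.color b) :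
    c.length + x.bot = b.length + x.top := by
  induction i generalizing b c with
  | zero => exact x.length_of_mem_color h
  | succ i ih =>
    cases b with
    | nil => simp [colorAt] at h
    | cons a b =>
      simp only [colorAt, Multiset.mem_map] at h
      obtain ⟨c, h, rfl⟩ := h
      have := ih h
      simp only [List.length_cons]
      omega

/-- The events act on disjoint parts of the row, so the choices made at them commute. If the row is
too short for `x`, it is also too short to reach position `x.bot + k`, and both sides are empty. -/
theorem colorRun_far (k : ℕ) (x y : Elem) (σ : List Q) :
    colorRun [⟨0, x⟩, ⟨x.top + k, y⟩] σ = colorRun [⟨x.bot + k, y⟩, ⟨0, x⟩] σ := by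
  by_cases h : σ.length < x.bot
  · simp only [colorRun_pair, Letter.color, colorAt, x.color_of_lt σ h, Multiset.zero_bind]
    rw [colorAt_eq_zero (by omega), Multiset.zero_bind]
  · obtain ⟨b, r, hb, rfl⟩ : ∃ b r, b.length = x.bot ∧ σ = b ++ r :=
      ⟨σ.take x.bot, σ.drop x.bot, by simp; omega, by simp⟩
    have h1 : ∀ c ∈ x.color b, c.length = x.top := fun c hc => by
      have := x.length_of_mem_color hc
      omega
    simp only [colorRun_pair, Letter.color, colorAt]
    rw [← hb, colorAt_append, Multiset.bind_map, x.color_append b r hb, Multiset.bind_map]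
    trans (x.color b).bind fun c => (colorAt k y.color r).map (c ++ ·)
    · refine Multiset.bind_congr fun c hc => ?_
      rw [← h1 c hc]
      exact colorAt_append c r k y.color
    · rw [Multiset.bind_map_comm]
      refine Multiset.bind_congr fun c hc => ?_
      exact (x.color_append b c hb).symm

end Coloring

/-! ### Strand counts -/

theorem Elem.length_of_act {x : Elem} {b c : List Bool} (h : x.act b = some c) :
    x.bot ≤ b.length ∧ c.length + x.bot = b.length + x.top := by
  match x, b, h with
  | .min _, b, h => cases h; exact ⟨Nat.zero_le _, rfl⟩
  | .max e, p :: q :: b, h =>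
    change (if p = e ∧ q = !e then some b else none) = some c at h
    split_ifs at h
    cases h
    exact ⟨Nat.le_add_left _ _, rfl⟩
  | .cross _, p :: q :: b, h => cases h; exact ⟨Nat.le_add_left _ _, rfl⟩

theorem Letter.length_of_act {l : Letter} {σ τ : List Bool} (h : l.act σ = some τ) :
    l.pos + l.elem.bot ≤ σ.length ∧ τ.length + l.elem.bot = σ.length + l.elem.top := by
  obtain ⟨i, x⟩ := l
  obtain ⟨a, b, c, h1, rfl, h2, rfl⟩ := exists_of_actAt h
  have : x.bot ≤ b.length ∧ c.length + x.bot = b.length + x.top := Elem.length_of_act h2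
  change a.length = i at h1
  change i + x.bot ≤ _ ∧ _ + x.bot = _ + x.top
  simp only [List.length_append]
  omega

/-- There are enough strands for a sequence of events, if it starts with `n` strands. -/
def Fits : List Letter → ℕ → Prop
  | [], _ => True
  | l :: w, n => l.pos + l.elem.bot ≤ n ∧ Fits w (n - l.elem.bot + l.elem.top)

/-! ### Invariance under planar isotopy and Reidemeister moves -/

section

variable {Q : Type} [SymQuandle Q] [Fintype Q] [DecidableEq Q]

/-- To compare two sequences of events it suffices to do so after removing the strands to the left
of both. -/
theorem colorRun_eq_of_shift {u v : List Letter} {i m n : ℕ} {σ : List Q} (hσ : σ.length = n)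
    (hn : i + m ≤ n) (h : ∀ b : List Q, m ≤ b.length → colorRun u b = colorRun v b) :
    colorRun (u.map (Letter.shift i)) σ = colorRun (v.map (Letter.shift i)) σ := by
  obtain ⟨a, b, rfl, rfl⟩ : ∃ a b, a.length = i ∧ σ = a ++ b :=
    ⟨σ.take i, σ.drop i, by simp; omega, by simp⟩
  rw [colorRun_shift, colorRun_shift, h b (by simp at hσ; omega)]

/-- `Fits` is needed because a row that is too short gives the empty multiset on one side, while an
empty word on the other side keeps the row. -/
theorem colorRun_eq_of_planarIsotopy {x y : List Letter} (h : PlanarIsotopy x y) {n : ℕ}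
    (hx : Fits x n) (hy : Fits y n) {σ : List Q} (hσ : σ.length = n) :
    colorRun x σ = colorRun y σ := by
  cases h with
  | far i k x y =>
    simp only [Fits, Elem.bot, Elem.top] at hx hy
    have := colorRun_eq_of_shift (u := [⟨0, x⟩, ⟨x.top + k, y⟩]) (v := [⟨x.bot + k, y⟩, ⟨0, x⟩])
      (i := i) (m := 0) hσ (by omega) fun b _ => colorRun_far k x y b
    simpa [Letter.shift, add_assoc] using this
  | zigzag i d =>
    simp only [Fits, Elem.bot, Elem.top] at hx hy
    refine colorRun_eq_of_shift (u := [⟨0, .min d⟩, ⟨1, .max (!d)⟩]) (v := [])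
      (i := i) (m := 1) hσ (by omega) fun b hb => ?_
    match b, hb with
    | c :: r, _ =>
      simp [Multiset.bind_map]
      simp only [eq_comm (a := c)]
      exact bind_ite_eq c fun a => {a :: r}
  | zagzig i d =>
    simp only [Fits, Elem.bot, Elem.top] at hx hy
    refine colorRun_eq_of_shift (u := [⟨1, .min d⟩, ⟨0, .max (!d)⟩]) (v := [])
      (i := i) (m := 1) hσ (by omega) fun b hb => ?_
    match b, hb with
    | c :: r, _ =>
      simp [Multiset.bind_map]
      rw [bind_ite_eq (inv c) fun a => {inv a :: r}, involutive]
  | slideMax i s d =>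
    simp only [Fits, Elem.bot, Elem.top] at hx hy
    refine colorRun_eq_of_shift (u := [⟨1, .cross s⟩, ⟨0, .max d⟩])
      (v := [⟨0, .cross (!s)⟩, ⟨1, .max d⟩]) (i := i) (m := 3) hσ (by omega) fun b hb => ?_
    match b, hb with
    | p :: q :: c :: r, _ =>
      cases s <;> simp
      · split_ifs with h
        · simp [h]
        · rfl
      · congr 1
        rw [act_eq_iff, act_inv]
  | slideMin i s d =>
    simp only [Fits, Elem.bot, Elem.top] at hx hy
    refine colorRun_eq_of_shift (u := [⟨0, .min d⟩, ⟨1, .cross s⟩])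
      (v := [⟨1, .min d⟩, ⟨0, .cross (!s)⟩]) (i := i) (m := 1) hσ (by omega) fun b hb => ?_
    match b, hb with
    | c :: r, _ =>
      cases s <;> simp [Multiset.bind_map]
      -- Here the strand `c` passes over a leg of the minimum, so the colours born on the two sides
      -- differ by the action of `c`.
      · simpa [actEquiv] using (map_univ_equiv (actEquiv c)
          fun x => x :: c :: inv (inv c ▷ x) :: r).symm

/-- The three moves are the quandle axioms: idempotence, invertibility of the action, and
self-distributivity. -/
theorem colorRun_eq_of_reidemeister {x y : List Letter} (h : Reidemeister x y) {n : ℕ}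
    (hx : Fits x n) (hy : Fits y n) {σ : List Q} (hσ : σ.length = n) :
    colorRun x σ = colorRun y σ := by
  cases h with
  | r1Min i d s =>
    simp only [Fits, Elem.bot, Elem.top] at hx hy
    refine colorRun_eq_of_shift (u := [⟨0, .min d⟩, ⟨0, .cross s⟩]) (v := [⟨0, .min (!d)⟩])
      (i := i) (m := 0) hσ (by omega) fun b hb => ?_
    cases s <;> simp [Multiset.bind_map]
    · simpa [invEquiv] using map_univ_equiv invEquiv fun a : Q => a :: inv a :: b
    · simpa [invEquiv] using map_univ_equiv invEquiv fun a : Q => a :: inv a :: b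
  | r1Max i d s =>
    simp only [Fits, Elem.bot, Elem.top] at hx hy
    refine colorRun_eq_of_shift (u := [⟨0, .cross s⟩, ⟨0, .max (!d)⟩]) (v := [⟨0, .max d⟩])
      (i := i) (m := 2) hσ (by omega) fun b hb => ?_
    match b, hb with
    | p :: q :: r, _ =>
      cases s <;> simp
      · congr 1
        rw [act_eq_iff, involutive, act_inv, act_self, eq_inv_comm]
      · congr 1
        rw [eq_inv_comm, act_eq_iff, act_inv, inv_act_self]
  | r2 i s =>
    simp only [Fits, Elem.bot, Elem.top] at hx hy
    refine colorRun_eq_of_shift (u := [⟨0, .cross s⟩, ⟨0, .cross (!s)⟩]) (v := [])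
      (i := i) (m := 2) hσ (by omega) fun b hb => ?_
    match b, hb with
    | p :: q :: r, _ =>
      cases s <;> simp
  | r3 i a b c h =>
    simp only [Fits, Elem.bot, Elem.top] at hx hy
    refine colorRun_eq_of_shift (u := [⟨0, .cross a⟩, ⟨1, .cross b⟩, ⟨0, .cross c⟩])
      (v := [⟨1, .cross c⟩, ⟨0, .cross b⟩, ⟨1, .cross a⟩])
      (i := i) (m := 3) hσ (by omega) fun t ht => ?_
    match t, ht with
    | p :: q :: r :: t, _ =>
      rcases a <;> rcases b <;> rcases c <;> first
      -- Only the two cyclic patterns, without a top strand, contradict `h`; the other six are left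
      -- to the next alternative.
      | simp at h; done
      | simp

end

/-! ### Colourings of symmetric diagrams, one row for each half plane -/

/-- Off the axis the two half planes are coloured independently of each other. -/
theorem bind_product {α β γ δ : Type} (s : Multiset α) (t : Multiset β) (f : α → Multiset γ)
    (g : β → Multiset δ) :
    ((s ×ˢ t).bind fun p => f p.1 ×ˢ g p.2) = s.bind f ×ˢ t.bind g := by
  induction s using Multiset.induction with
  | empty => simp
  | cons a s ih =>
    simp only [Multiset.cons_product, Multiset.add_bind, ih, Multiset.cons_bind,
      Multiset.add_product, Multiset.bind_map]
    congr 1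
    clear ih
    induction t using Multiset.induction with
    | empty => simp
    | cons b t ih' => simp [ih', Multiset.product_add]

theorem product_eq_bind {α β : Type} (s : Multiset α) (t : Multiset β) :
    s ×ˢ t = s.bind fun a => t.map fun b => (a, b) := rfl

/-- There are enough strands for an event of a symmetric diagram with `n` strands in each half
plane. -/
def SLetter.bot : SLetter → ℕ
  | off l => l.pos + l.elem.bot
  | axis x => x.bot

/-- The number of strands in the right half plane after an event. -/
def SLetter.next : SLetter → ℕ → ℕ
  | off l, n => n - l.elem.bot + l.elem.top
  | axis x, n => n - x.bot + x.top

/-- There are enough strands for a sequence of events of a symmetric diagram, if it starts with `n`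
strands in each half plane. -/
def SFits : List SLetter → ℕ → Prop
  | [], _ => True
  | l :: w, n => l.bot ≤ n ∧ SFits w (l.next n)

theorem SLetter.length_of_act {l : SLetter} {σ τ : List Bool} (h : l.act σ = some τ) :
    l.bot ≤ σ.length ∧ τ.length = l.next σ.length := by
  match l, σ, h with
  | .off l, σ, h =>
    have := Letter.length_of_act h
    simp only [SLetter.bot, SLetter.next]
    omega
  | .axis (.min _), σ, h => cases h; exact ⟨Nat.zero_le _, rfl⟩
  | .axis (.max d), a :: σ, h =>
    change (if a = d then some σ else none) = some τ at h
    split_ifs at h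
    cases h
    exact ⟨Nat.le_add_left _ _, rfl⟩
  | .axis (.cross _), a :: σ, h => cases h; exact ⟨Nat.le_add_left _ _, rfl⟩

theorem sfits_of_srun {w : List SLetter} {σ τ : List Bool} (h : srun w σ = some τ) :
    SFits w σ.length := by
  induction w generalizing σ with
  | nil => trivial
  | cons l w ih =>
    simp only [srun, Option.bind_eq_some_iff] at h
    obtain ⟨ρ, h1, h2⟩ := h
    have h3 := l.length_of_act h1
    exact ⟨h3.1, h3.2 ▸ ih h2⟩

theorem fits_of_sfits {w : List Letter} {n : ℕ} (h : SFits (w.map .off) n) : Fits w n := by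
  induction w generalizing n with
  | nil => trivial
  | cons l w ih => exact ⟨h.1, ih h.2⟩

section

variable {Q : Type} [SymQuandle Q] [Fintype Q] [DecidableEq Q]

/-- The colours of the strands above an event on the axis. The strands in either half plane are
listed from the axis outwards, and those on the left carry the inverses of their colours. A crossing
on the axis acts as a full twist of the two strands. -/
def AxisElem.color : AxisElem → List Q × List Q → Multiset (List Q × List Q)
  | min _, (σ, τ) => (Finset.univ : Finset Q).val.map fun a => (a :: σ, a :: τ)
  | max _, (a :: σ, b :: τ) => if a = b then {(σ, τ)} else 0
  | cross true, (a :: σ, b :: τ) => {((inv a ▷ b ▷ a) :: σ, (inv a ▷ b) :: τ)}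
  | cross false, (a :: σ, b :: τ) => {((inv b ▷ a) :: σ, (inv b ▷ a ▷ b) :: τ)}
  | _, _ => 0

def SLetter.color : SLetter → List Q × List Q → Multiset (List Q × List Q)
  | off l, s => l.color s.1 ×ˢ l.color s.2
  | axis x, s => x.color s

/-- The colours of the strands above a sequence of events, with multiplicities. -/
def scolorRun : List SLetter → List Q × List Q → Multiset (List Q × List Q)
  | [], s => {s}
  | l :: w, s => (l.color s).bind fun t => scolorRun w t

@[simp] theorem AxisElem.color_min (d : Bool) (σ τ : List Q) :
    (AxisElem.min d).color (σ, τ) =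
      (Finset.univ : Finset Q).val.map fun a => (a :: σ, a :: τ) := rfl

@[simp] theorem AxisElem.color_max (d : Bool) (a b : Q) (σ τ : List Q) :
    (AxisElem.max d).color (a :: σ, b :: τ) = if a = b then {(σ, τ)} else 0 := rfl

@[simp] theorem AxisElem.color_cross_true (a b : Q) (σ τ : List Q) :
    (AxisElem.cross true).color (a :: σ, b :: τ) =
      {((inv a ▷ b ▷ a) :: σ, (inv a ▷ b) :: τ)} := rfl

@[simp] theorem AxisElem.color_cross_false (a b : Q) (σ τ : List Q) :
    (AxisElem.cross false).color (a :: σ, b :: τ) =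
      {((inv b ▷ a) :: σ, (inv b ▷ a ▷ b) :: τ)} := rfl

@[simp] theorem SLetter.color_off (l : Letter) (s : List Q × List Q) :
    (SLetter.off l).color s = l.color s.1 ×ˢ l.color s.2 := rfl

@[simp] theorem SLetter.color_axis (x : AxisElem) (s : List Q × List Q) :
    (SLetter.axis x).color s = x.color s := rfl

@[simp] theorem scolorRun_nil (s : List Q × List Q) : scolorRun [] s = {s} := rfl

@[simp] theorem scolorRun_cons (l : SLetter) (w : List SLetter) (s : List Q × List Q) :
    scolorRun (l :: w) s = (l.color s).bind fun t => scolorRun w t := rfl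

theorem scolorRun_append (u v : List SLetter) (s : List Q × List Q) :
    scolorRun (u ++ v) s = (scolorRun u s).bind (scolorRun v) := by
  induction u generalizing s with
  | nil => simp
  | cons l u ih => simp [Multiset.bind_assoc, ih]

theorem scolorRun_off (w : List Letter) (s : List Q × List Q) :
    scolorRun (w.map .off) s = colorRun w s.1 ×ˢ colorRun w s.2 := by
  induction w generalizing s with
  | nil => rfl
  | cons l w ih =>
    simp only [List.map_cons, scolorRun_cons, SLetter.color_off, ih, colorRun_cons]
    exact bind_product _ _ _ _

theorem AxisElem.color_append (x : AxisElem) (σ τ σ' τ' : List Q) (h : σ.length = x.bot)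
    (h' : τ.length = x.bot) :
    x.color (σ ++ σ', τ ++ τ') = (x.color (σ, τ)).map fun t => (t.1 ++ σ', t.2 ++ τ') := by
  match x, σ, h, τ, h' with
  | .min _, [], _, [], _ => simp
  | .max _, [a], _, [b], _ => simp
  | .cross true, [a], _, [b], _ => simp
  | .cross false, [a], _, [b], _ => simp

theorem AxisElem.length_of_mem_color (x : AxisElem) {s t : List Q × List Q} (h : t ∈ x.color s) :
    x.bot ≤ s.1.length ∧ x.bot ≤ s.2.length ∧ t.1.length = s.1.length - x.bot + x.top ∧
      t.2.length = s.2.length - x.bot + x.top := by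
  match x, s, h with
  | .min _, (σ, τ), h =>
    simp only [AxisElem.color_min, Multiset.mem_map] at h
    obtain ⟨a, -, rfl⟩ := h
    simp [AxisElem.bot, AxisElem.top]
  | .max _, (a :: σ, b :: τ), h =>
    simp only [AxisElem.color_max] at h
    split at h <;> simp_all [AxisElem.bot, AxisElem.top]
  | .cross true, (a :: σ, b :: τ), h => simp_all [AxisElem.bot, AxisElem.top]
  | .cross false, (a :: σ, b :: τ), h => simp_all [AxisElem.bot, AxisElem.top]

theorem Letter.length_of_mem_color {l : Letter} {σ τ : List Q} (h : τ ∈ l.color σ) :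
    τ.length + l.elem.bot = σ.length + l.elem.top :=
  length_of_mem_colorAt h

theorem SLetter.length_of_mem_color {l : SLetter} {s t : List Q × List Q} (h : t ∈ l.color s)
    {n : ℕ} (hn : l.bot ≤ n) (h1 : s.1.length = n) (h2 : s.2.length = n) :
    t.1.length = l.next n ∧ t.2.length = l.next n := by
  cases l with
  | off l =>
    simp only [SLetter.color_off, Multiset.mem_product] at h
    have h3 := Letter.length_of_mem_color h.1
    have h4 := Letter.length_of_mem_color h.2
    simp only [SLetter.bot, SLetter.next] at hn ⊢
    omega
  | axis x =>
    have h3 := x.length_of_mem_color h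
    simp only [SLetter.next]
    omega

theorem length_of_mem_scolorRun {w : List SLetter} {σ τ : List Bool} (h : srun w σ = some τ)
    {s t : List Q × List Q} (ht : t ∈ scolorRun w s) (h1 : s.1.length = σ.length)
    (h2 : s.2.length = σ.length) : t.1.length = τ.length ∧ t.2.length = τ.length := by
  induction w generalizing σ s with
  | nil =>
    simp only [srun, Option.some.injEq, scolorRun_nil, Multiset.mem_singleton] at h ht
    subst h ht
    exact ⟨h1, h2⟩
  | cons l w ih =>
    simp only [srun, Option.bind_eq_some_iff, scolorRun_cons, Multiset.mem_bind] at h ht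
    obtain ⟨ρ, hρ, h⟩ := h
    obtain ⟨r, hr, ht⟩ := ht
    have h3 := l.length_of_act hρ
    have h4 := l.length_of_mem_color hr h3.1 h1 h2
    exact ih h ht (by omega) (by omega)

theorem scolorRun_far (k : ℕ) (x : AxisElem) (y : Elem) {s : List Q × List Q} {n : ℕ}
    (hx : x.bot ≤ n) (h1 : s.1.length = n) (h2 : s.2.length = n) :
    scolorRun [.axis x, .off ⟨x.top + k, y⟩] s = scolorRun [.off ⟨x.bot + k, y⟩, .axis x] s := by
  obtain ⟨σ, τ⟩ := s
  obtain ⟨a, b, ha, rfl⟩ : ∃ a b, a.length = x.bot ∧ σ = a ++ b :=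
    ⟨σ.take x.bot, σ.drop x.bot, by simp at h1 ⊢; omega, by simp⟩
  obtain ⟨c, e, hc, rfl⟩ : ∃ a b, a.length = x.bot ∧ τ = a ++ b :=
    ⟨τ.take x.bot, τ.drop x.bot, by simp at h2 ⊢; omega, by simp⟩
  trans (x.color (a, c)).bind fun t => (colorAt k y.color b).bind fun p =>
    (colorAt k y.color e).map fun q => (t.1 ++ p, t.2 ++ q)
  · simp only [scolorRun_cons, scolorRun_nil, SLetter.color_axis, SLetter.color_off,
      x.color_append a c b e ha hc, Multiset.bind_map, Letter.color]
    refine Multiset.bind_congr fun t ht => ?_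
    have ht := x.length_of_mem_color ht
    simp only at ht
    have e1 := colorAt_append t.1 b k y.color
    have e2 := colorAt_append t.2 e k y.color
    rw [show t.1.length = x.top by omega] at e1
    rw [show t.2.length = x.top by omega] at e2
    rw [e1, e2, product_eq_bind]
    simp [Multiset.bind_assoc, Multiset.bind_map]
  · simp only [scolorRun_cons, scolorRun_nil, SLetter.color_axis, SLetter.color_off, Letter.color]
    rw [show x.bot + k = a.length + k by rw [ha], colorAt_append, ha, ← hc, colorAt_append,
      product_eq_bind]
    simp only [Multiset.bind_assoc, Multiset.bind_map, x.color_append a c _ _ ha hc]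
    rw [Multiset.bind_bind]
    refine Multiset.bind_congr fun p _ => ?_
    rw [Multiset.bind_map_comm]
    refine Multiset.bind_congr fun q _ => ?_
    exact (Multiset.bind_singleton _ _).symm

end

/-! ### The full twist, and invariance under the moves on the axis -/

section

variable {Q : Type} [SymQuandle Q]

theorem bind_ite_eq' {α β : Type} [Fintype α] [DecidableEq α] (c : α) (g : α → Multiset β) :
    ((Finset.univ : Finset α).val.bind fun a => if c = a then g a else 0) = g c := by
  simp only [eq_comm (a := c), bind_ite_eq]

theorem eq_act_iff {a b : Q} : a = a ▷ b ↔ a = b := by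
  have h := act_inj (a := a) (b := a) (c := b)
  rwa [act_self] at h

/-- The colours above a crossing on the axis. -/
def twist : Bool → Q → Q → Q × Q
  | true, a, b => (inv a ▷ b ▷ a, inv a ▷ b)
  | false, a, b => (inv b ▷ a, inv b ▷ a ▷ b)

theorem twist_act (s : Bool) (g a b : Q) :
    twist s (g ▷ a) (g ▷ b) = (g ▷ (twist s a b).1, g ▷ (twist s a b).2) := by
  cases s <;> simp [twist]

/-- A full twist preserves the product `b⁻¹a`. If `a'`, `b'` are the colours above it, then `b'⁻¹a'
= b⁻¹a`, that is, `a'a⁻¹ = b'b⁻¹`: a strand pushed across the twist is conjugated by the same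
element on both sides of the axis. -/
theorem twist_act_inv_act (s : Bool) (a b c : Q) :
    (twist s a b).1 ▷ inv a ▷ c = (twist s a b).2 ▷ inv b ▷ c := by
  cases s <;> simp [twist]

theorem act_inv_twist_act (s : Bool) (a b c : Q) :
    a ▷ inv (twist s a b).1 ▷ c = b ▷ inv (twist s a b).2 ▷ c := by
  cases s <;> simp [twist]

variable [Fintype Q] [DecidableEq Q]

theorem bind_bind_univ_equiv {α β : Type} [Fintype α] (e : α ≃ α) (g : α → α → Multiset β) :
    ((Finset.univ : Finset α).val.bind fun a => (Finset.univ : Finset α).val.bind fun b =>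
      g (e a) (e b)) =
    (Finset.univ : Finset α).val.bind fun a => (Finset.univ : Finset α).val.bind fun b => g a b := by
  simp only [Multiset.bind]
  rw [map_univ_equiv e fun a => ((Finset.univ : Finset α).val.map fun b => g a (e b)).join]
  simp only [map_univ_equiv e]

theorem AxisElem.color_cross (s : Bool) (a b : Q) (σ τ : List Q) :
    (AxisElem.cross s).color (a :: σ, b :: τ) =
      {((twist s a b).1 :: σ, (twist s a b).2 :: τ)} := by
  cases s <;> rfl

theorem bind_color_off_min (d : Bool) (σ τ : List Q) {β : Type} (f : List Q × List Q → Multiset β) :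
    ((SLetter.off ⟨0, .min d⟩).color (σ, τ)).bind f =
      (Finset.univ : Finset Q).val.bind fun a => (Finset.univ : Finset Q).val.bind fun b =>
        f (a :: inv a :: σ, b :: inv b :: τ) := by
  simp [product_eq_bind, Multiset.bind_map, Multiset.bind_assoc]

theorem bind_color_off_max (d : Bool) (a a' b b' : Q) (σ τ : List Q) {β : Type}
    (f : List Q × List Q → Multiset β) :
    ((SLetter.off ⟨0, .max d⟩).color (a :: a' :: σ, b :: b' :: τ)).bind f =
      if a' = inv a ∧ b' = inv b then f (σ, τ) else 0 := by
  simp [ite_and]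

theorem bind_color_cross (s : Bool) (a b : Q) (σ τ : List Q) {β : Type}
    (f : List Q × List Q → Multiset β) :
    ((SLetter.axis (.cross s)).color (a :: σ, b :: τ)).bind f =
      f ((twist s a b).1 :: σ, (twist s a b).2 :: τ) := by
  simp [AxisElem.color_cross]

/-- The four crossings carry the inner pair over the outer one, so only the outer pair changes, by
the product `pq`. -/
theorem scolorRun_exchange_true (p q x x' p' q' y y' : Q) (σ τ : List Q) (w : List SLetter) :
    scolorRun (.off ⟨1, .cross true⟩ :: .off ⟨0, .cross true⟩ :: .off ⟨2, .cross true⟩ ::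
      .off ⟨1, .cross true⟩ :: w) (p :: q :: x :: x' :: σ, p' :: q' :: y :: y' :: τ) =
    scolorRun w ((p ▷ q ▷ x) :: (p ▷ q ▷ x') :: p :: q :: σ,
      (p' ▷ q' ▷ y) :: (p' ▷ q' ▷ y') :: p' :: q' :: τ) := by
  simp

theorem scolorRun_exchange_false (p q x x' p' q' y y' : Q) (σ τ : List Q) (w : List SLetter) :
    scolorRun (.off ⟨1, .cross false⟩ :: .off ⟨0, .cross false⟩ :: .off ⟨2, .cross false⟩ ::
      .off ⟨1, .cross false⟩ :: w) (p :: q :: x :: x' :: σ, p' :: q' :: y :: y' :: τ) =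
    scolorRun w (x :: x' :: (inv x' ▷ inv x ▷ p) :: (inv x' ▷ inv x ▷ q) :: σ,
      y :: y' :: (inv y' ▷ inv y ▷ p') :: (inv y' ▷ inv y ▷ q') :: τ) := by
  simp

/-- The pair that passes under is conjugated on each side of the axis by the product of the colours
of the other pair. These two products agree because the twist of the over-passing pair preserves
`b⁻¹a`. As `twist` commutes with a common conjugation, the twist of the under-passing pair does not
notice it. -/
theorem scolorRun_exchange (d e s m n : Bool) (x x' y y' : Q) (σ τ : List Q) :
    scolorRun [.off ⟨0, .min d⟩, .axis (.cross n),
        .off ⟨1, .cross s⟩, .off ⟨0, .cross s⟩, .off ⟨2, .cross s⟩, .off ⟨1, .cross s⟩,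
        .axis (.cross m), .off ⟨0, .max e⟩] (x :: x' :: σ, y :: y' :: τ) =
      scolorRun [.axis (.cross m), .off ⟨0, .max e⟩, .off ⟨0, .min d⟩, .axis (.cross n)]
        (x :: x' :: σ, y :: y' :: τ) := by
  rw [scolorRun_cons, bind_color_off_min]
  conv_rhs => rw [scolorRun_cons, bind_color_cross, scolorRun_cons, bind_color_off_max,
    scolorRun_cons, bind_color_off_min]
  simp only [scolorRun_cons (.axis (.cross n)), bind_color_cross, scolorRun_nil]
  cases s with
  | true =>
    simp only [scolorRun_exchange_true, scolorRun_cons (.axis (.cross m)), bind_color_cross,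
      scolorRun_cons (.off ⟨0, .max e⟩), bind_color_off_max, scolorRun_nil,
      ← twist_act_inv_act n, twist_act, ← act_inv, act_inj, bind_ite_zero]
  | false =>
    simp only [scolorRun_exchange_false, scolorRun_cons (.axis (.cross m)), bind_color_cross,
      scolorRun_cons (.off ⟨0, .max e⟩), bind_color_off_max, scolorRun_nil, bind_ite_zero]
    refine ite_congr rfl ?_ fun _ => rfl
    rintro ⟨rfl, rfl⟩
    -- The maxima have determined `x'` and `y'`, so these are the conjugations undergone by the
    -- newborn pair on the left and on the right.
    have h (c : Q) : (twist m x y).2 ▷ inv y ▷ c = (twist m x y).1 ▷ inv x ▷ c := by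
      have := act_inv_twist_act m x y ((twist m x y).2 ▷ inv y ▷ c)
      simpa [act_eq_iff] using this
    simp only [involutive, h]
    -- The common conjugation is absorbed by reindexing both colours born at the minima.
    simpa [actEquiv, twist_act] using bind_bind_univ_equiv
      ((actEquiv (inv x)).trans (actEquiv (twist m x y).1)) fun a b => {((twist n a b).1 :: inv a :: σ, (twist n a b).2 :: inv b :: τ)}


theorem scolorRun_eq_of_symIsotopy {x y : List SLetter} (h : SymIsotopy x y) {n : ℕ}
    (hx : SFits x n) (hy : SFits y n) {s : List Q × List Q} (h1 : s.1.length = n)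
    (h2 : s.2.length = n) : scolorRun x s = scolorRun y s := by
  cases h with
  | off h =>
    have hx := fits_of_sfits hx
    have hy := fits_of_sfits hy
    rw [scolorRun_off, scolorRun_off, colorRun_eq_of_planarIsotopy h hx hy h1,
      colorRun_eq_of_planarIsotopy h hx hy h2]
  | far k x y => exact scolorRun_far k x y hx.1 h1 h2
  | axisMax d =>
    simp only [SFits, SLetter.bot, SLetter.next, AxisElem.bot] at hx hy
    obtain ⟨_ | ⟨a, σ⟩, _ | ⟨b, τ⟩⟩ := s <;> simp at h1 h2 <;> try omega
    simp only [scolorRun_cons, scolorRun_nil, SLetter.color_axis, SLetter.color_off,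
      AxisElem.color_min, AxisElem.color_max, Letter.color_zero, Elem.color_max, Multiset.bind_map,
      ite_zero_product_ite_zero, ite_zero_bind, eq_inv_comm (a := a), bind_ite_eq]
    simp [eq_comm]
  | axisMin d =>
    obtain ⟨σ, τ⟩ := s
    simp only [scolorRun_cons, scolorRun_nil, SLetter.color_axis, SLetter.color_off,
      AxisElem.color_min, AxisElem.color_max, Letter.color_zero, Elem.color_min, Multiset.bind_map,
      product_eq_bind, ite_zero_bind, Multiset.map_map, Multiset.bind_assoc, Function.comp_def,
      bind_ite_eq', Multiset.singleton_bind]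
    simpa [invEquiv] using map_univ_equiv invEquiv fun a : Q => (a :: σ, a :: τ)

/-- The arc on the axis forces equal colours in the two rows, and a twist fixes a pair of equal
colours. -/
theorem scolorRun_eq_of_s1Move {x y : List SLetter} (h : S1Move x y) {n : ℕ}
    (hx : SFits x n) {s : List Q × List Q} (h1 : s.1.length = n)
    (h2 : s.2.length = n) : scolorRun x s = scolorRun y s := by
  cases h with
  | max d t =>
    simp only [SFits, SLetter.bot, SLetter.next, AxisElem.bot] at hx
    obtain ⟨_ | ⟨a, σ⟩, _ | ⟨b, τ⟩⟩ := s <;> simp at h1 h2 <;> try omega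
    cases t <;> simp only [scolorRun_cons, scolorRun_nil, SLetter.color_axis,
      AxisElem.color_max, AxisElem.color_cross_true, AxisElem.color_cross_false,
      Multiset.singleton_bind, ite_zero_bind] <;> congr 1
    · rw [act_inj, eq_act_iff]
    · rw [act_inj, act_eq_iff, inv_act_self]
  | min d t =>
    obtain ⟨σ, τ⟩ := s
    cases t <;> simp [Multiset.bind_map]

theorem scolorRun_eq_of_s2vMove {x y : List SLetter} (h : S2vMove x y) {n : ℕ}
    (hx : SFits x n) {s : List Q × List Q} (h1 : s.1.length = n)
    (h2 : s.2.length = n) : scolorRun x s = scolorRun y s := by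
  cases h with
  | mk t =>
    simp only [SFits, SLetter.bot, SLetter.next, AxisElem.bot] at hx
    obtain ⟨_ | ⟨a, σ⟩, _ | ⟨b, τ⟩⟩ := s <;> simp at h1 h2 <;> try omega
    cases t <;> simp

/-- The moves on the axis hold because `twist` is equivariant, invertible and preserves `b⁻¹a`. The
case split is over the over-strand and the sense of the twist. -/
theorem scolorRun_eq_of_symReidemeister {x y : List SLetter} (h : SymReidemeister x y) {n : ℕ}
    (hx : SFits x n) (hy : SFits y n) {s : List Q × List Q} (h1 : s.1.length = n)
    (h2 : s.2.length = n) : scolorRun x s = scolorRun y s := by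
  cases h with
  | off h =>
    have hx := fits_of_sfits hx
    have hy := fits_of_sfits hy
    rw [scolorRun_off, scolorRun_off, colorRun_eq_of_reidemeister h hx hy h1,
      colorRun_eq_of_reidemeister h hx hy h2]
  | s2h d e t =>
    simp only [SFits, SLetter.bot, SLetter.next, AxisElem.bot] at hx hy
    obtain ⟨_ | ⟨a, σ⟩, _ | ⟨b, τ⟩⟩ := s <;> simp at h1 h2 <;> try omega
    cases t <;> simp [Multiset.bind_map]
    split_ifs with hab
    -- The colour of the arc that passes under changes by `a` on one side and by `b` on the other;
    -- the maximum makes these equal.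
    · subst hab
      simpa [actEquiv] using map_univ_equiv (actEquiv (inv a)) fun c => (c :: σ, c :: τ)
    · rfl
  | s2 d e t u =>
    simp only [SFits, SLetter.bot, SLetter.next, AxisElem.bot, Elem.bot, Elem.top] at hx hy
    obtain ⟨_ | ⟨a, σ⟩, _ | ⟨b, τ⟩⟩ := s <;> simp at h1 h2 <;> try omega
    cases t <;> cases u <;>
      simp [Multiset.bind_map, product_eq_bind, Multiset.bind_assoc]
    -- The two maxima give two equations for the colours born at the two minima, and these are the
    -- unique solutions; likewise in the next three cases.
    · rw [bind_bind_ite_eq (inv (a ▷ inv b ▷ a)) (inv (a ▷ b))]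
      · simp
      · intro x y
        constructor <;> rintro ⟨rfl, rfl⟩ <;> simp
    · rw [bind_bind_ite_eq (inv (b ▷ a)) (inv (b ▷ inv a ▷ b))]
      · simp
      · intro x y
        constructor <;> rintro ⟨rfl, rfl⟩ <;> simp
    · simp only [act_eq_iff]
      rw [bind_bind_ite_eq (inv (inv b ▷ a)) (inv (inv b ▷ a ▷ b))]
      · simp
      · intro x y
        constructor <;> rintro ⟨rfl, rfl⟩ <;> simp
    · simp only [act_eq_iff]
      rw [bind_bind_ite_eq (inv (inv a ▷ b ▷ a)) (inv (inv a ▷ b))]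
      · simp
      · intro x y
        constructor <;> rintro ⟨rfl, rfl⟩ <;> simp
  | s3 d t u =>
    simp only [SFits, SLetter.bot, SLetter.next, AxisElem.bot] at hx hy
    obtain ⟨_ | ⟨a, σ⟩, _ | ⟨b, τ⟩⟩ := s <;> simp at h1 h2 <;> try omega
    cases t <;> cases u <;> simp [Multiset.bind_map]
    -- The arc passes under here, and its colour is reindexed by the commutator `aa'⁻¹ = bb'⁻¹`,
    -- with `a'`, `b'` the colours above the twist. When the arc passes over, equivariance of the
    -- twist suffices.
    · simpa [actEquiv] using (map_univ_equiv ((((actEquiv b).trans (actEquiv (inv a))).trans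
        (actEquiv (inv b))).trans (actEquiv a)) fun x =>
          (inv b ▷ a :: inv a ▷ x :: σ, inv b ▷ a ▷ b :: inv b ▷ x :: τ)).symm
    · simpa [actEquiv] using (map_univ_equiv ((((actEquiv a).trans (actEquiv (inv b))).trans
        (actEquiv (inv a))).trans (actEquiv b)) fun x =>
          (inv a ▷ b ▷ a :: inv a ▷ x :: σ, inv a ▷ b :: inv b ▷ x :: τ)).symm
  | s3Max d t u =>
    simp only [SFits, SLetter.bot, SLetter.next, Elem.bot] at hx hy
    obtain ⟨_ | ⟨a, _ | ⟨a', σ⟩⟩, _ | ⟨b, _ | ⟨b', τ⟩⟩⟩ := s <;> simp at h1 h2 <;> try omega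
    cases t <;> cases u <;> simp
    · split_ifs with hab
      · subst hab; simp
      · rfl
    · split_ifs with hab
      · subst hab; simp
      · rfl
    · simp only [act_eq_iff]
    · simp only [act_eq_iff, involutive]
  | s4 d e t m k =>
    simp only [SFits, SLetter.bot, SLetter.next, AxisElem.bot, AxisElem.top, Elem.bot, Elem.top] at hx hy
    obtain ⟨_ | ⟨a, _ | ⟨a', σ⟩⟩, _ | ⟨b, _ | ⟨b', τ⟩⟩⟩ := s <;> simp at h1 h2 <;> try omega
    exact scolorRun_exchange d e t m k a a' b b' σ τ

end

/-! ### Rotation by π, as transposition of the transitions -/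

section

variable {Q : Type} [SymQuandle Q] [Fintype Q] [DecidableEq Q]

/-- An event upside down. -/
def Elem.flip : Elem → Elem
  | min d => max d
  | max d => min d
  | cross s => cross (!s)

theorem Elem.mem_color_flip (x : Elem) {σ τ : List Q} (h : τ ∈ x.color σ) :
    σ ∈ x.flip.color τ := by
  match x, σ, h with
  | .min _, σ, h =>
    simp only [Elem.color_min, Multiset.mem_map] at h
    obtain ⟨a, -, rfl⟩ := h
    simp [Elem.flip]
  | .max _, a :: b :: σ, h =>
    simp only [Elem.color_max] at h
    split_ifs at h with hb
    · simp only [Multiset.mem_singleton] at h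
      simp [Elem.flip, h, hb]
    · simp at h
  | .cross true, a :: b :: σ, h =>
    simp only [Elem.color_cross_true, Multiset.mem_singleton] at h
    simp [Elem.flip, h]
  | .cross false, a :: b :: σ, h =>
    simp only [Elem.color_cross_false, Multiset.mem_singleton] at h
    simp [Elem.flip, h]

/-- Single events have multiplicities 0 and 1, so reversing the membership relation is enough to
reverse the counts. -/
theorem Elem.nodup_color (x : Elem) (σ : List Q) : (x.color σ).Nodup := by
  match x, σ with
  | .min _, σ => exact Finset.univ.nodup.map fun a b h => by simpa using congrArg List.head? h
  | .max _, a :: b :: σ =>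
    simp only [Elem.color_max]
    split_ifs <;> simp
  | .cross true, a :: b :: σ => simp
  | .cross false, a :: b :: σ => simp
  | .max _, [] => exact Multiset.nodup_zero
  | .max _, [_] => exact Multiset.nodup_zero
  | .cross true, [] => exact Multiset.nodup_zero
  | .cross true, [_] => exact Multiset.nodup_zero
  | .cross false, [] => exact Multiset.nodup_zero
  | .cross false, [_] => exact Multiset.nodup_zero

theorem mem_colorAt_flip (x : Elem) (i : ℕ) {σ τ : List Q} (h : τ ∈ colorAt i x.color σ) :
    σ ∈ colorAt i x.flip.color τ := by
  induction i generalizing σ τ with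
  | zero => exact x.mem_color_flip h
  | succ i ih =>
    cases σ with
    | nil => simp [colorAt] at h
    | cons a σ =>
      simp only [colorAt, Multiset.mem_map] at h
      obtain ⟨ρ, hρ, rfl⟩ := h
      simp only [colorAt, Multiset.mem_map]
      exact ⟨σ, ih hρ, rfl⟩

theorem nodup_colorAt (x : Elem) (i : ℕ) (σ : List Q) : (colorAt i x.color σ).Nodup := by
  induction i generalizing σ with
  | zero => exact x.nodup_color σ
  | succ i ih =>
    cases σ with
    | nil => exact Multiset.nodup_zero
    | cons a σ => exact (ih σ).map fun _ _ h => by simpa using h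

theorem AxisElem.nodup_color (x : AxisElem) (s : List Q × List Q) : (x.color s).Nodup := by
  match x, s with
  | .min _, (σ, τ) =>
    refine Finset.univ.nodup.map fun a b h => ?_
    simpa using congrArg (fun s => s.1.head?) h
  | .max _, (a :: σ, b :: τ) =>
    simp only [AxisElem.color_max]
    split_ifs <;> simp
  | .cross true, (a :: σ, b :: τ) => simp
  | .cross false, (a :: σ, b :: τ) => simp
  | .max _, ([], _) => exact Multiset.nodup_zero
  | .max _, (_ :: _, []) => exact Multiset.nodup_zero
  | .cross true, ([], _) => exact Multiset.nodup_zero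
  | .cross true, (_ :: _, []) => exact Multiset.nodup_zero
  | .cross false, ([], _) => exact Multiset.nodup_zero
  | .cross false, (_ :: _, []) => exact Multiset.nodup_zero

theorem SLetter.nodup_color (l : SLetter) (s : List Q × List Q) : (l.color s).Nodup := by
  cases l with
  | off l => exact (nodup_colorAt _ _ _).product (nodup_colorAt _ _ _)
  | axis x => exact x.nodup_color s

theorem SLetter.rotate_off (i : ℕ) (x : Elem) :
    (SLetter.off ⟨i, x⟩).rotate = .off ⟨i, x.flip⟩ := by
  cases x <;> rfl

theorem SLetter.rotate_rotate (l : SLetter) : l.rotate.rotate = l := by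
  rcases l with ⟨i, _ | _ | _⟩ | (_ | _ | _) <;> simp [SLetter.rotate]

/-- Rotation turns upward strands downward, which would invert the colours, and exchanges the half
planes. Since the left row records inverses, the net effect is just the exchange of the rows. -/
theorem SLetter.mem_color_rotate (l : SLetter) {s t : List Q × List Q} (h : t ∈ l.color s) :
    s.swap ∈ l.rotate.color t.swap := by
  match l, s, h with
  | .off ⟨i, x⟩, s, h =>
    rw [SLetter.rotate_off]
    simp only [SLetter.color_off, Multiset.mem_product] at h ⊢
    exact ⟨mem_colorAt_flip x i h.2, mem_colorAt_flip x i h.1⟩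
  | .axis (.min _), (σ, τ), h =>
    simp only [SLetter.color_axis, AxisElem.color_min, Multiset.mem_map] at h
    obtain ⟨a, -, rfl⟩ := h
    simp [SLetter.rotate]
  | .axis (.max _), (a :: σ, b :: τ), h =>
    simp only [SLetter.color_axis, AxisElem.color_max] at h
    split_ifs at h with hb
    · simp only [Multiset.mem_singleton] at h
      simp [SLetter.rotate, h, hb]
    · simp at h
  | .axis (.cross true), (a :: σ, b :: τ), h =>
    simp only [SLetter.color_axis, AxisElem.color_cross_true, Multiset.mem_singleton] at h
    simp [SLetter.rotate, h]
  | .axis (.cross false), (a :: σ, b :: τ), h =>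
    simp only [SLetter.color_axis, AxisElem.color_cross_false, Multiset.mem_singleton] at h
    simp [SLetter.rotate, h]

theorem SLetter.count_color_rotate (l : SLetter) (s t : List Q × List Q) :
    (l.rotate.color t.swap).count s.swap = (l.color s).count t := by
  rw [Multiset.count_eq_of_nodup (l.nodup_color s),
    Multiset.count_eq_of_nodup (l.rotate.nodup_color t.swap)]
  congr 1
  refine propext ⟨fun h => ?_, l.mem_color_rotate⟩
  have := l.rotate.mem_color_rotate h
  rwa [l.rotate_rotate] at this

/-- With `f` and `g` seen as transposed matrices and `B` as a vector, both sides are the entry at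
`s` of the same product. -/
theorem sum_map_count_comm {α : Type} [DecidableEq α] (B : Multiset α) (f g : α → Multiset α)
    (h : ∀ a b, (f a).count b = (g b).count a) (s : α) :
    ((f s).map fun t => B.count t).sum = (B.bind g).count s := by
  induction B using Multiset.induction with
  | empty => simp
  | cons b B ih =>
    simp only [Multiset.cons_bind, Multiset.count_add, ← ih, ← h, Multiset.count_cons,
      Multiset.sum_map_add]
    rw [add_comm]
    congr 1
    generalize f s = C
    induction C using Multiset.induction with
    | empty => simp
    | cons c C ih =>
      simp only [Multiset.map_cons, Multiset.sum_cons, ih, Multiset.count_cons, eq_comm (a := b)]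
      omega

theorem rotate_cons (l : SLetter) (w : List SLetter) : rotate (l :: w) = rotate w ++ [l.rotate] := by
  simp [rotate]

theorem count_scolorRun_rotate (w : List SLetter) (s t : List Q × List Q) :
    (scolorRun (rotate w) t.swap).count s.swap = (scolorRun w s).count t := by
  induction w generalizing s with
  | nil =>
    simp only [rotate, List.map_nil, List.reverse_nil, scolorRun_nil, Multiset.count_singleton,
      Prod.swap_inj]
    simp only [eq_comm]
  | cons l w ih =>
    -- The transpose of the transition of the rotated event is that of `l`, conjugated by the
    -- exchange of the two rows.
    have h := sum_map_count_comm (scolorRun (rotate w) t.swap)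
      (fun r => (l.color r.swap).map Prod.swap) l.rotate.color (fun a b => by
        rw [← Prod.swap_swap b, Multiset.count_map_eq_count' _ _ Prod.swap_injective]
        simpa using (l.count_color_rotate a.swap b.swap).symm) s.swap
    simp only [Multiset.map_map, Prod.swap_swap, Function.comp_def, ih] at h
    rw [rotate_cons, scolorRun_append, scolorRun_cons, Multiset.count_bind (m := l.color s), h]
    congr 1
    refine Multiset.bind_congr fun r _ => ?_
    rw [scolorRun_cons]
    exact (Multiset.bind_singleton _ fun r => r).trans (Multiset.map_id' _)

/-! ### The number of colourings as an invariant -/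

/-- The number of colourings of a symmetric diagram. -/
def SymDiagram.colorings (Q : Type) [SymQuandle Q] [Fintype Q] [DecidableEq Q] (D : SymDiagram) :
    ℕ :=
  (scolorRun (Q := Q) D.word ([], [])).count ([], [])

theorem srun_append (u v : List SLetter) (σ : List Bool) :
    srun (u ++ v) σ = (srun u σ).bind (srun v) := by
  induction u generalizing σ with
  | nil => rfl
  | cons l u ih => simp [srun, Option.bind_assoc, ih]

theorem sfits_of_srun_append {a x b : List SLetter} {σ τ ρ : List Bool}
    (h : srun (a ++ x ++ b) σ = some τ) (ha : srun a σ = some ρ) : SFits x ρ.length := by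
  rw [List.append_assoc, srun_append, ha, Option.bind_some, srun_append] at h
  simp only [Option.bind_eq_some_iff] at h
  obtain ⟨_, h, -⟩ := h
  exact sfits_of_srun h

/-- The common prefix determines the number of strands that enter the replaced piece. Both words are
closed, so both pieces fit on that many strands, and the local equality applies to every pair of
rows that reaches them. -/
theorem colorings_eq_of_rewrites {M : List SLetter → List SLetter → Prop}
    (hM : ∀ {x y : List SLetter}, M x y → ∀ {n : ℕ}, SFits x n → SFits y n →
      ∀ {s : List Q × List Q}, s.1.length = n → s.2.length = n → scolorRun x s = scolorRun y s)
    {D E : SymDiagram} (h : Rewrites M D.word E.word) : D.colorings Q = E.colorings Q := by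
  obtain ⟨a, b, x, y, hxy, hD, hE⟩ := h
  have h1 := D.closed
  have h2 := E.closed
  rw [hD] at h1
  rw [hE] at h2
  obtain ⟨ρ, hρ⟩ : ∃ ρ, srun a [] = some ρ := by
    rw [List.append_assoc, srun_append] at h1
    simp only [Option.bind_eq_some_iff] at h1
    obtain ⟨ρ, hρ, -⟩ := h1
    exact ⟨ρ, hρ⟩
  rw [SymDiagram.colorings, SymDiagram.colorings, hD, hE]
  congr 1
  simp only [List.append_assoc, scolorRun_append]
  refine Multiset.bind_congr fun s hs => ?_
  have hl := length_of_mem_scolorRun hρ hs rfl rfl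
  rw [hM hxy (sfits_of_srun_append h1 hρ) (sfits_of_srun_append h2 hρ) hl.1 hl.2]

theorem colorings_eq_of_weakStep {D E : SymDiagram} (h : WeakStep D E) :
    D.colorings Q = E.colorings Q := by
  rcases h with h | h | h | h | h
  · exact colorings_eq_of_rewrites scolorRun_eq_of_symIsotopy h
  · rw [SymDiagram.colorings, SymDiagram.colorings, h]
    exact (count_scolorRun_rotate D.word ([], []) ([], [])).symm
  · exact colorings_eq_of_rewrites scolorRun_eq_of_symReidemeister h
  · exact colorings_eq_of_rewrites (fun h _ hx _ _ h1 h2 => scolorRun_eq_of_s1Move h hx h1 h2) h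
  · exact colorings_eq_of_rewrites (fun h _ hx _ _ h1 h2 => scolorRun_eq_of_s2vMove h hx h1 h2) h

/-- The number of colourings is an invariant of weak symmetric equivalence. -/
theorem WeaklySymmetricallyEquivalent.colorings_eq {D E : SymDiagram}
    (h : WeaklySymmetricallyEquivalent D E) : D.colorings Q = E.colorings Q := by
  induction h with
  | rel _ _ h => exact colorings_eq_of_weakStep h
  | refl _ => rfl
  | symm _ _ _ ih => exact ih.symm
  | trans _ _ _ _ _ ih1 ih2 => exact ih1.trans ih2

end

/-! ### The quandle of three-cycles -/

/-- The multiplication table of the conjugation of the three-cycles in the alternating group on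
five letters, five binary digits for each entry. Two consecutive elements `2 * k` and `2 * k + 1`
are inverse to each other. -/
def threeCycleTable : ℕ :=
  70192018925486102181651581532741571128418901250080867712938966094637513496928003996600666829723638647483523568067751591431654396664901553864613558233532870775471155266345573828314401787919790809486002745407048399445080906303078758112611556631330081471656364879157055733296264310221230175296038076206166259124258522663523297067383832792563777378862683394043728068775981756496160428096099124636731136060953888727679204417795669071637189408990128109916890706135173166622796379893879782184062008814888323686129388087414857309794882944260293221905109367888136424358643754726530811006662767054680602226956320

def threeCycleAct (a b : ℕ) : ℕ := (threeCycleTable >>> (5 * (20 * a + b))) % 32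

theorem threeCycleAct_lt : ∀ a < 20, ∀ b < 20, threeCycleAct a b < 20 := by decide +kernel

def ThreeCycle : Type := Fin 20

instance : Fintype ThreeCycle := inferInstanceAs (Fintype (Fin 20))
instance : DecidableEq ThreeCycle := inferInstanceAs (DecidableEq (Fin 20))

instance : SymQuandle ThreeCycle where
  act a b := ⟨threeCycleAct a.1 b.1, threeCycleAct_lt a.1 a.2 b.1 b.2⟩
  inv a := ⟨a.1 ^^^ 1, by revert a; change ∀ a : Fin 20, a.1 ^^^ 1 < 20; decide +kernel⟩
  involutive := by change ∀ a : Fin 20, _ = _; decide +kernel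
  act_self := by change ∀ a : Fin 20, _ = _; decide +kernel
  act_inv := by change ∀ a b : Fin 20, _ = _; decide +kernel
  inv_act_act := by change ∀ a b : Fin 20, _ = _; decide +kernel
  act_act := by change ∀ a b c : Fin 20, _ = _; decide +kernel

/-! ### Conjugation symmetry of colourings -/

section

variable {Q : Type} [SymQuandle Q]

/-- Act by an element on all the colours of a row of strands. -/
def actList (g : Q) (σ : List Q) : List Q := σ.map (g ▷ ·)

theorem actList_injective (g : Q) : Function.Injective (actList g) :=
  List.map_injective_iff.2 (actEquiv g).injective

variable [Fintype Q] [DecidableEq Q]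

theorem Elem.color_actList (x : Elem) (g : Q) (σ : List Q) :
    x.color (actList g σ) = (x.color σ).map (actList g) := by
  match x, σ with
  | .min _, σ =>
    have h := map_univ_equiv (actEquiv g) fun a => a :: inv a :: actList g σ
    simpa [actEquiv, actList, Function.comp_def] using h.symm
  | .max _, a :: b :: σ => simp [actList, ← act_inv]
  | .cross true, a :: b :: σ => simp [actList]
  | .cross false, a :: b :: σ => simp [actList]
  | .max _, [] => rfl
  | .max _, [_] => rfl
  | .cross true, [] => rfl
  | .cross true, [_] => rfl
  | .cross false, [] => rfl
  | .cross false, [_] => rfl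

theorem colorAt_actList (x : Elem) (i : ℕ) (g : Q) (σ : List Q) :
    colorAt i x.color (actList g σ) = (colorAt i x.color σ).map (actList g) := by
  induction i generalizing σ with
  | zero => exact x.color_actList g σ
  | succ i ih =>
    cases σ with
    | nil => rfl
    | cons a σ =>
      change (colorAt i x.color (actList g σ)).map (g ▷ a :: ·) = _
      rw [ih, colorAt, Multiset.map_map, Multiset.map_map]
      rfl

def actPair (g : Q) (s : List Q × List Q) : List Q × List Q := (actList g s.1, actList g s.2)

theorem AxisElem.color_actPair (x : AxisElem) (g : Q) (s : List Q × List Q) :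
    x.color (actPair g s) = (x.color s).map (actPair g) := by
  match x, s with
  | .min _, (σ, τ) =>
    have h := map_univ_equiv (actEquiv g) fun a => (a :: actList g σ, a :: actList g τ)
    simpa [actEquiv, actPair, actList, Function.comp_def] using h.symm
  | .max _, (a :: σ, b :: τ) => simp [actPair, actList]
  | .cross true, (a :: σ, b :: τ) => simp [actPair, actList]
  | .cross false, (a :: σ, b :: τ) => simp [actPair, actList]
  | .max _, ([], _) => rfl
  | .max _, (_ :: _, []) => rfl
  | .cross true, ([], _) => rfl
  | .cross true, (_ :: _, []) => rfl
  | .cross false, ([], _) => rfl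
  | .cross false, (_ :: _, []) => rfl

theorem SLetter.color_actPair (l : SLetter) (g : Q) (s : List Q × List Q) :
    l.color (actPair g s) = (l.color s).map (actPair g) := by
  cases l with
  | off l =>
    simp only [SLetter.color_off, actPair, Letter.color, colorAt_actList, product_eq_bind,
      Multiset.bind_map, Multiset.map_bind, Multiset.map_map, Function.comp_def]
  | axis x => exact x.color_actPair g s

theorem scolorRun_actPair (w : List SLetter) (g : Q) (s : List Q × List Q) :
    scolorRun w (actPair g s) = (scolorRun w s).map (actPair g) := by
  induction w generalizing s with
  | nil => simp
  | cons l w ih =>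
    simp only [scolorRun_cons, l.color_actPair, Multiset.bind_map, ih, Multiset.map_bind]

/-- Conjugating all colours is injective, commutes with every event and fixes the empty rows. This
permits fixing the first colour before counting. -/
theorem count_scolorRun_actPair (w : List SLetter) (g : Q) (s : List Q × List Q) :
    (scolorRun w (actPair g s)).count ([], []) = (scolorRun w s).count ([], []) := by
  rw [scolorRun_actPair]
  exact Multiset.count_map_eq_count' (actPair g) _
    (Function.Injective.prodMap (actList_injective g) (actList_injective g)) ([], [])

end

/-! ### Counting colourings by evaluation -/

/-- The elements of the quandle of three-cycles. -/
def ThreeCycle.all : List ThreeCycle := List.finRange 20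

/-- Evaluate the argument of a function before the function. -/
def ThreeCycle.eager : ThreeCycle → (ThreeCycle → ℕ) → ℕ
  | ⟨0, h⟩, k => k ⟨0, h⟩
  | ⟨n + 1, h⟩, k => k ⟨n + 1, h⟩

theorem ThreeCycle.eager_eq (a : ThreeCycle) (k : ThreeCycle → ℕ) : a.eager k = k a := by
  obtain ⟨_ | n, h⟩ := a <;> rfl

/-- The sum of a function over the colours of the strands above an event. -/
def sumColors : Elem → ℕ → List ThreeCycle → (List ThreeCycle → ℕ) → ℕ
  | x, i + 1, a :: σ, k => sumColors x i σ fun τ => k (a :: τ)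
  | .min _, 0, σ, k => (ThreeCycle.all.map fun a => (inv a).eager fun b => k (a :: b :: σ)).sum
  | .max _, 0, a :: b :: σ, k => if b = inv a then k σ else 0
  | .cross true, 0, a :: b :: σ, k => (a ▷ b).eager fun c => k (c :: a :: σ)
  | .cross false, 0, a :: b :: σ, k => (inv b ▷ a).eager fun c => k (b :: c :: σ)
  | _, _, _, _ => 0

/-- The continuation `k` counts the rest of the word: no multiset is built, a failed maximum prunes
its branch at once, and `eager` has the colours evaluated before they are passed on. -/
def axisSumColors : AxisElem → List ThreeCycle → List ThreeCycle →
    (List ThreeCycle → List ThreeCycle → ℕ) → ℕ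
  | .min _, σ, τ, k => (ThreeCycle.all.map fun a => k (a :: σ) (a :: τ)).sum
  | .max _, a :: σ, b :: τ, k => if a = b then k σ τ else 0
  | .cross true, a :: σ, b :: τ, k =>
    (inv a ▷ b).eager fun b' => (inv a ▷ b ▷ a).eager fun a' => k (a' :: σ) (b' :: τ)
  | .cross false, a :: σ, b :: τ, k =>
    (inv b ▷ a).eager fun a' => (inv b ▷ a ▷ b).eager fun b' => k (a' :: σ) (b' :: τ)
  | _, _, _, _ => 0

/-- A depth-first count of colourings. -/
def countColors : List SLetter → List ThreeCycle → List ThreeCycle → ℕ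
  | .off l :: w, σ, τ => sumColors l.elem l.pos σ fun σ' => sumColors l.elem l.pos τ fun τ' =>
      countColors w σ' τ'
  | .axis x :: w, σ, τ => axisSumColors x σ τ fun σ' τ' => countColors w σ' τ'
  | [], [], [] => 1
  | [], _, _ => 0

theorem ThreeCycle.map_univ {β : Type} (f : ThreeCycle → β) :
    (Finset.univ : Finset ThreeCycle).val.map f = (ThreeCycle.all.map f : List β) := rfl

theorem sum_map_ite_zero {β : Type} (p : Prop) [Decidable p] (b : β) (k : β → ℕ) :
    ((if p then ({b} : Multiset β) else 0).map k).sum = if p then k b else 0 := by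
  split_ifs <;> simp

theorem sumColors_eq (x : Elem) (i : ℕ) (σ : List ThreeCycle) (k : List ThreeCycle → ℕ) :
    sumColors x i σ k = ((colorAt i x.color σ).map k).sum := by
  induction i generalizing σ k with
  | succ i ih =>
    cases σ with
    | nil => cases x <;> rfl
    | cons a σ =>
      rw [sumColors, ih, colorAt, Multiset.map_map]
      rfl
  | zero =>
    match x, σ with
    | .min _, σ =>
      simp [sumColors, colorAt, ThreeCycle.eager_eq, ThreeCycle.map_univ, Function.comp_def]
    | .max _, a :: b :: σ =>
      rw [colorAt, Elem.color_max, sum_map_ite_zero, sumColors]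
    | .cross true, a :: b :: σ => simp [sumColors, colorAt, ThreeCycle.eager_eq]
    | .cross false, a :: b :: σ => simp [sumColors, colorAt, ThreeCycle.eager_eq]
    | .max _, [] => rfl
    | .max _, [_] => rfl
    | .cross true, [] => rfl
    | .cross true, [_] => rfl
    | .cross false, [] => rfl
    | .cross false, [_] => rfl

theorem axisSumColors_eq (x : AxisElem) (σ τ : List ThreeCycle)
    (k : List ThreeCycle → List ThreeCycle → ℕ) :
    axisSumColors x σ τ k = ((x.color (σ, τ)).map fun t => k t.1 t.2).sum := by
  match x, σ, τ with
  | .min _, σ, τ => simp [axisSumColors, ThreeCycle.map_univ, Function.comp_def]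
  | .max _, a :: σ, b :: τ =>
    rw [AxisElem.color_max, sum_map_ite_zero, axisSumColors]
  | .cross true, a :: σ, b :: τ => simp [axisSumColors, ThreeCycle.eager_eq]
  | .cross false, a :: σ, b :: τ => simp [axisSumColors, ThreeCycle.eager_eq]
  | .max _, [], _ => rfl
  | .max _, _ :: _, [] => rfl
  | .cross true, [], _ => rfl
  | .cross true, _ :: _, [] => rfl
  | .cross false, [], _ => rfl
  | .cross false, _ :: _, [] => rfl

theorem countColors_eq (w : List SLetter) (σ τ : List ThreeCycle) :
    countColors w σ τ = (scolorRun w (σ, τ)).count ([], []) := by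
  induction w generalizing σ τ with
  | nil => cases σ <;> cases τ <;> simp [countColors]
  | cons l w ih =>
    cases l with
    | off l =>
      simp only [countColors, sumColors_eq, ih, scolorRun_cons, Multiset.count_bind,
        SLetter.color_off, Letter.color]
      rw [product_eq_bind, Multiset.map_bind, Multiset.sum_bind]
      simp [Multiset.map_map]
    | axis x =>
      simp only [countColors, axisSumColors_eq, ih, scolorRun_cons, Multiset.count_bind,
        SLetter.color_axis]

def ThreeCycle.base : ThreeCycle := ⟨0, by decide⟩

/-- The three-cycles form a single conjugacy class, and two conjugations by three-cycles suffice to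
reach any of them from a given one. -/
theorem ThreeCycle.exists_act (a : ThreeCycle) :
    ∃ b c : ThreeCycle, a = b ▷ c ▷ ThreeCycle.base := by
  revert a
  decide +kernel

/-- All colours of the first strand lead to the same number of colourings. -/
theorem colorings_eq_twenty_mul {D : SymDiagram} {d : Bool} {w : List SLetter}
    (h : D.word = .axis (.min d) :: w) :
    D.colorings ThreeCycle = 20 * countColors w [ThreeCycle.base] [ThreeCycle.base] := by
  have key (a : ThreeCycle) : (scolorRun w ([a], [a])).count ([], []) =
      countColors w [ThreeCycle.base] [ThreeCycle.base] := by
    obtain ⟨b, c, rfl⟩ := a.exists_act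
    rw [countColors_eq, ← count_scolorRun_actPair w c ([ThreeCycle.base], [ThreeCycle.base]),
      ← count_scolorRun_actPair w b (actPair c _)]
    rfl
  rw [SymDiagram.colorings, h]
  simp only [scolorRun_cons, SLetter.color_axis, AxisElem.color_min, Multiset.bind_map,
    Multiset.count_bind, key, Multiset.map_const', Multiset.sum_replicate, smul_eq_mul]
  rw [show Multiset.card (Finset.univ : Finset ThreeCycle).val = 20 from rfl]

/-- Each of the twenty colours of the first strand extends in seven ways. -/
theorem colorings_D4 (d : Bool) : (D4 d).colorings ThreeCycle = 140 := by
  rw [colorings_eq_twenty_mul rfl]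
  cases d <;> decide +kernel

/-- Only the trivial colourings exist, in which all strands carry one colour or its inverse. -/
theorem colorings_D4' (d : Bool) : (D4' d).colorings ThreeCycle = 20 := by
  rw [colorings_eq_twenty_mul rfl]
  cases d <;> decide +kernel

theorem not_weaklySymmetricallyEquivalent_D4_D4' (d d' : Bool) :
    ¬ WeaklySymmetricallyEquivalent (D4 d) (D4' d') := by
  intro h
  have := h.colorings_eq (Q := ThreeCycle)
  rw [colorings_D4, colorings_D4'] at this
  omega

/-! ### Both diagrams are symmetric unions -/

/-- A Boolean test for two points to be joined by an arc that passes at most one event. -/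
def joinedTest (w : List SLetter) (p q : Point) : Bool :=
  bif q.level == p.level + 1 then
    match w[p.level]? with
    | some (.off ⟨i, x⟩) => p.right == q.right &&
      (decide (p.pos < i ∧ q.pos = p.pos) ||
        decide (i + x.bot ≤ p.pos ∧ q.pos = i + x.top + (p.pos - (i + x.bot))) ||
        match x with
        | .cross _ => decide (p.pos = i ∧ q.pos = i + 1 ∨ p.pos = i + 1 ∧ q.pos = i)
        | _ => false)
    | some (.axis x) =>
      (p.right == q.right && decide (x.bot ≤ p.pos ∧ q.pos = x.top + (p.pos - x.bot))) ||
        match x with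
        | .cross _ => decide (p.pos = 0 ∧ q.pos = 0 ∧ q.right = !p.right)
        | _ => false
    | none => false
  else
    (match w[p.level]? with
    | some (.off ⟨i, .max _⟩) =>
      decide (q.level = p.level ∧ p.right = q.right ∧ p.pos = i ∧ q.pos = i + 1)
    | some (.axis (.max _)) =>
      decide (q.level = p.level ∧ p.right = false ∧ q.right = true ∧ p.pos = 0 ∧ q.pos = 0)
    | _ => false) ||
    (match w[p.level - 1]? with
    | some (.off ⟨i, .min _⟩) =>
      decide (0 < p.level ∧ q.level = p.level ∧ p.right = q.right ∧ p.pos = i ∧ q.pos = i + 1)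
    | some (.axis (.min _)) =>
      decide (0 < p.level ∧ q.level = p.level ∧ p.right = false ∧ q.right = true ∧
        p.pos = 0 ∧ q.pos = 0)
    | _ => false)

theorem joined_of_joinedTest {w : List SLetter} {p q : Point} (h : joinedTest w p q = true) :
    Joined w p q := by
  obtain ⟨k, i, r⟩ := p
  obtain ⟨k', i', r'⟩ := q
  simp only [joinedTest, cond_eq_ite, beq_iff_eq] at h
  split_ifs at h with hk
  · subst hk
    split at h
    · rename_i j x hw
      simp only [Bool.and_eq_true, Bool.or_eq_true, beq_iff_eq, decide_eq_true_eq] at h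
      obtain ⟨rfl, (⟨h1, rfl⟩ | ⟨h1, rfl⟩) | h⟩ := h
      · exact .below k j i' x r hw h1
      · obtain ⟨m, rfl⟩ := Nat.exists_eq_add_of_le h1
        rw [Nat.add_sub_cancel_left]
        exact .beyond k j m x r hw
      · split at h
        · simp only [decide_eq_true_eq] at h
          obtain ⟨rfl, rfl⟩ | ⟨rfl, rfl⟩ := h
          · exact .crossOut k i _ r hw
          · exact .crossIn k i' _ r hw
        · simp at h
    · rename_i x hw
      simp only [Bool.and_eq_true, Bool.or_eq_true, beq_iff_eq, decide_eq_true_eq] at h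
      obtain ⟨rfl, h1, rfl⟩ | h := h
      · obtain ⟨m, rfl⟩ := Nat.exists_eq_add_of_le h1
        rw [Nat.add_sub_cancel_left]
        exact .axisBeyond k m x r hw
      · split at h
        · simp only [decide_eq_true_eq] at h
          obtain ⟨rfl, rfl, rfl⟩ := h
          exact .axisCross k _ r hw
        · simp at h
    · simp at h
  · rw [Bool.or_eq_true] at h
    obtain h | h := h
    · split at h
      · rename_i hw
        simp only [decide_eq_true_eq] at h
        obtain ⟨rfl, rfl, rfl, rfl⟩ := h
        exact .max _ _ _ _ hw
      · rename_i hw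
        simp only [decide_eq_true_eq] at h
        obtain ⟨rfl, rfl, rfl, rfl, rfl⟩ := h
        exact .axisMax _ _ hw
      · simp at h
    · split at h
      · rename_i hw
        simp only [decide_eq_true_eq] at h
        obtain ⟨h0, rfl, rfl, rfl, rfl⟩ := h
        obtain ⟨m, rfl⟩ := Nat.exists_eq_add_of_lt h0
        simp only [zero_add, Nat.add_sub_cancel] at hw ⊢
        exact .min _ _ _ _ hw
      · rename_i hw
        simp only [decide_eq_true_eq] at h
        obtain ⟨h0, rfl, rfl, rfl, rfl, rfl⟩ := h
        obtain ⟨m, rfl⟩ := Nat.exists_eq_add_of_lt h0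
        simp only [zero_add, Nat.add_sub_cancel] at hw ⊢
        exact .axisMin _ _ hw
      · simp at h

/-- Test for consecutive points to be joined by arcs that pass at most one event. -/
def pathTest (w : List SLetter) : Point → List Point → Bool
  | _, [] => true
  | p, q :: l => (joinedTest w p q || joinedTest w q p) && pathTest w q l

theorem eqvGen_of_pathTest {w : List SLetter} {p q : Point} {l : List Point}
    (h : pathTest w p l = true) (hq : q ∈ p :: l) : Relation.EqvGen (Joined w) p q := by
  induction l generalizing p with
  | nil =>
    simp only [List.mem_singleton] at hq
    exact hq ▸ .refl _
  | cons r l ih =>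
    simp only [pathTest, Bool.and_eq_true, Bool.or_eq_true] at h
    obtain rfl | hq := List.mem_cons.1 hq
    · exact .refl _
    · refine .trans _ _ _ ?_ (ih h.2 hq)
      exact h.1.elim (fun h => .rel _ _ (joined_of_joinedTest h))
        fun h => (Relation.EqvGen.rel _ _ (joined_of_joinedTest h)).symm

instance : DecidableEq Point := fun p q =>
  decidable_of_iff (p.level = q.level ∧ p.pos = q.pos ∧ p.right = q.right)
    (by cases p; cases q; simp)

/-- Test for a list of points to contain, with all points of a symmetric diagram, their mirror
images. -/
def coverTest (w : List SLetter) (l : List Point) : Bool :=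
  (List.range w.length).all fun k => match srun (w.take k) [] with
    | some σ => (List.range σ.length).all fun i =>
      decide ((⟨k, i, true⟩ : Point) ∈ l) && decide ((⟨k, i, false⟩ : Point) ∈ l)
    | none => true

/-- A walk that visits every point and its mirror image puts all of them on the component of its
starting point. -/
theorem isSymmetricUnion_of_tests {D : SymDiagram} {p : Point} {l : List Point}
    (h : pathTest D.word p l = true) (hl : coverTest D.word (p :: l) = true) :
    D.IsSymmetricUnion := by
  intro k i σ hσ hi
  rcases Nat.lt_or_ge k D.word.length with hk | hk
  · have h1 := List.all_eq_true.1 hl k (List.mem_range.2 hk)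
    rw [hσ] at h1
    have h2 := List.all_eq_true.1 h1 i (List.mem_range.2 hi)
    simp only [Bool.and_eq_true, decide_eq_true_eq] at h2
    exact (eqvGen_of_pathTest h h2.1).symm.trans _ _ _ (eqvGen_of_pathTest h h2.2)
  -- At or above the level of the last event there are no strands left.
  · rw [List.take_of_length_le hk, D.closed, Option.some.injEq] at hσ
    subst hσ
    simp at hi

/-- The points of the diagram `D₄`, along the knot. -/
def pathD4 : List Point := [
    ⟨1, 0, true⟩, ⟨2, 2, true⟩, ⟨3, 1, true⟩, ⟨4, 1, true⟩, ⟨5, 0, true⟩, ⟨6, 0, false⟩,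
    ⟨7, 1, false⟩, ⟨8, 1, false⟩, ⟨9, 0, false⟩, ⟨10, 0, true⟩, ⟨11, 0, true⟩, ⟨12, 1, true⟩,
    ⟨12, 2, true⟩, ⟨11, 2, true⟩, ⟨10, 1, true⟩, ⟨9, 1, true⟩, ⟨8, 0, true⟩, ⟨7, 0, false⟩,
    ⟨6, 1, false⟩, ⟨5, 1, false⟩, ⟨4, 0, false⟩, ⟨3, 0, true⟩, ⟨2, 0, true⟩, ⟨2, 1, true⟩,
    ⟨3, 2, true⟩, ⟨4, 2, true⟩, ⟨5, 2, true⟩, ⟨6, 2, true⟩, ⟨7, 2, true⟩, ⟨8, 2, true⟩,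
    ⟨9, 2, true⟩, ⟨10, 2, true⟩, ⟨11, 1, true⟩, ⟨12, 0, true⟩, ⟨13, 0, true⟩, ⟨13, 0, false⟩,
    ⟨12, 0, false⟩, ⟨11, 1, false⟩, ⟨10, 2, false⟩, ⟨9, 2, false⟩, ⟨8, 2, false⟩, ⟨7, 2, false⟩,
    ⟨6, 2, false⟩, ⟨5, 2, false⟩, ⟨4, 2, false⟩, ⟨3, 2, false⟩, ⟨2, 1, false⟩, ⟨2, 0, false⟩,
    ⟨3, 0, false⟩, ⟨4, 0, true⟩, ⟨5, 1, true⟩, ⟨6, 1, true⟩, ⟨7, 0, true⟩, ⟨8, 0, false⟩,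
    ⟨9, 1, false⟩, ⟨10, 1, false⟩, ⟨11, 2, false⟩, ⟨12, 2, false⟩, ⟨12, 1, false⟩, ⟨11, 0, false⟩,
    ⟨10, 0, false⟩, ⟨9, 0, true⟩, ⟨8, 1, true⟩, ⟨7, 1, true⟩, ⟨6, 0, true⟩, ⟨5, 0, false⟩,
    ⟨4, 1, false⟩, ⟨3, 1, false⟩, ⟨2, 2, false⟩, ⟨1, 0, false⟩]

/-- The points of the diagram `D'₄`, along the knot. -/
def pathD4' : List Point := [
    ⟨1, 0, true⟩, ⟨2, 0, true⟩, ⟨3, 1, true⟩, ⟨4, 0, true⟩, ⟨5, 0, false⟩, ⟨6, 1, false⟩,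
    ⟨7, 1, false⟩, ⟨8, 0, false⟩, ⟨9, 0, false⟩, ⟨10, 1, false⟩, ⟨10, 2, false⟩, ⟨9, 2, false⟩,
    ⟨8, 1, false⟩, ⟨7, 0, false⟩, ⟨6, 0, true⟩, ⟨5, 1, true⟩, ⟨4, 1, true⟩, ⟨3, 0, true⟩,
    ⟨2, 1, true⟩, ⟨2, 2, true⟩, ⟨3, 2, true⟩, ⟨4, 2, true⟩, ⟨5, 2, true⟩, ⟨6, 2, true⟩,
    ⟨7, 2, true⟩, ⟨8, 2, true⟩, ⟨9, 1, true⟩, ⟨10, 0, true⟩, ⟨11, 0, true⟩, ⟨11, 0, false⟩,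
    ⟨10, 0, false⟩, ⟨9, 1, false⟩, ⟨8, 2, false⟩, ⟨7, 2, false⟩, ⟨6, 2, false⟩, ⟨5, 2, false⟩,
    ⟨4, 2, false⟩, ⟨3, 2, false⟩, ⟨2, 2, false⟩, ⟨2, 1, false⟩, ⟨3, 0, false⟩, ⟨4, 1, false⟩,
    ⟨5, 1, false⟩, ⟨6, 0, false⟩, ⟨7, 0, true⟩, ⟨8, 1, true⟩, ⟨9, 2, true⟩, ⟨10, 2, true⟩,
    ⟨10, 1, true⟩, ⟨9, 0, true⟩, ⟨8, 0, true⟩, ⟨7, 1, true⟩, ⟨6, 1, true⟩, ⟨5, 0, true⟩,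
    ⟨4, 0, false⟩, ⟨3, 1, false⟩, ⟨2, 0, false⟩, ⟨1, 0, false⟩]

theorem isSymmetricUnion_D4 (d : Bool) : (D4 d).IsSymmetricUnion :=
  isSymmetricUnion_of_tests (p := ⟨1, 0, false⟩) (l := pathD4)
    (by cases d <;> decide +kernel) (by cases d <;> decide +kernel)

theorem isSymmetricUnion_D4' (d : Bool) : (D4' d).IsSymmetricUnion :=
  isSymmetricUnion_of_tests (p := ⟨1, 0, false⟩) (l := pathD4')
    (by cases d <;> decide +kernel) (by cases d <;> decide +kernel)

/-! ### Checkable sequences of Reidemeister moves -/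

/-- Two words that differ by one relation of planar isotopy or one Reidemeister move. -/
def DiagramStep (u v : List Letter) : Prop :=
  (Rewrites PlanarIsotopy u v ∨ Rewrites Reidemeister u v) ∨
    Rewrites PlanarIsotopy v u ∨ Rewrites Reidemeister v u

theorem Rewrites.append {α : Type} {M : List α → List α → Prop} {u v : List α}
    (h : Rewrites M u v) (a b : List α) : Rewrites M (a ++ u ++ b) (a ++ v ++ b) := by
  obtain ⟨c, d, x, y, hxy, rfl, rfl⟩ := h
  exact ⟨a ++ c, d ++ b, x, y, hxy, by simp, by simp⟩

theorem DiagramStep.append_left {u v : List Letter} (h : DiagramStep u v) (a : List Letter) :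
    DiagramStep (a ++ u) (a ++ v) := by
  have key {M : List Letter → List Letter → Prop} {u v : List Letter} (h : Rewrites M u v) :
      Rewrites M (a ++ u) (a ++ v) := by
    simpa using h.append a []
  exact h.imp (Or.imp key key) (Or.imp key key)

theorem DiagramStep.symm {u v : List Letter} (h : DiagramStep u v) : DiagramStep v u := Or.symm h

theorem DiagramStep.isotopy {x y : List Letter} (h : PlanarIsotopy x y) (b : List Letter) :
    DiagramStep (x ++ b) (y ++ b) :=
  .inl (.inl ⟨[], b, x, y, h, rfl, rfl⟩)

theorem DiagramStep.reidemeister {x y : List Letter} (h : Reidemeister x y) (b : List Letter) :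
    DiagramStep (x ++ b) (y ++ b) :=
  .inl (.inr ⟨[], b, x, y, h, rfl, rfl⟩)

/-- Exchange the first two events of a word, which must be distant. -/
def exchange : List Letter → Option (List Letter)
  | l :: m :: w =>
    if l.pos + l.elem.top ≤ m.pos then
      some (⟨l.pos + l.elem.bot + (m.pos - (l.pos + l.elem.top)), m.elem⟩ :: l :: w)
    else if m.pos + m.elem.bot ≤ l.pos then
      some (m :: ⟨m.pos + m.elem.top + (l.pos - (m.pos + m.elem.bot)), l.elem⟩ :: w)
    else none
  | _ => none

theorem diagramStep_of_exchange {u v : List Letter} (h : exchange u = some v) :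
    DiagramStep u v := by
  match u, h with
  | ⟨i, x⟩ :: ⟨j, y⟩ :: w, h =>
    simp only [exchange] at h
    split_ifs at h with h1 h2
    · obtain ⟨k, rfl⟩ := Nat.exists_eq_add_of_le h1
      rw [Nat.add_sub_cancel_left, Option.some.injEq] at h
      subst h
      exact .isotopy (.far i k x y) w
    · obtain ⟨k, rfl⟩ := Nat.exists_eq_add_of_le h2
      rw [Nat.add_sub_cancel_left, Option.some.injEq] at h
      subst h
      exact (DiagramStep.isotopy (.far j k y x) w).symm

/-- Remove a kink or a pair of crossings at the beginning of a word. -/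
def simplify : List Letter → Option (List Letter)
  | ⟨i, .cross s⟩ :: ⟨j, .cross t⟩ :: w => if j = i ∧ t = !s then some w else none
  | ⟨i, .min d⟩ :: ⟨j, .cross _⟩ :: w => if j = i then some (⟨i, .min (!d)⟩ :: w) else none
  | ⟨i, .cross _⟩ :: ⟨j, .max d⟩ :: w => if j = i then some (⟨i, .max (!d)⟩ :: w) else none
  | _ => none

theorem diagramStep_of_simplify {u v : List Letter} (h : simplify u = some v) :
    DiagramStep u v := by
  unfold simplify at h
  split at h <;> (try split_ifs at h with hc) <;> cases h
  · obtain ⟨rfl, rfl⟩ := hc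
    exact .reidemeister (.r2 _ _) _
  · subst hc
    exact .reidemeister (.r1Min _ _ _) _
  · subst hc
    rename_i s j d w
    have h := DiagramStep.reidemeister (.r1Max j (!d) s) w
    rw [Bool.not_not] at h
    exact h

/-- Insert a kink at the minimum or maximum at the beginning of a word. -/
def insertKink (s : Bool) : List Letter → Option (List Letter)
  | ⟨i, .min d⟩ :: w => some (⟨i, .min (!d)⟩ :: ⟨i, .cross s⟩ :: w)
  | ⟨i, .max d⟩ :: w => some (⟨i, .cross s⟩ :: ⟨i, .max (!d)⟩ :: w)
  | _ => none

theorem diagramStep_of_insertKink {s : Bool} {u v : List Letter} (h : insertKink s u = some v) :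
    DiagramStep u v := by
  unfold insertKink at h
  split at h <;> cases h
  · rename_i i d w
    have h := DiagramStep.reidemeister (.r1Min i (!d) s) w
    rw [Bool.not_not] at h
    exact h.symm
  · exact (DiagramStep.reidemeister (.r1Max _ _ s) _).symm

/-- Move a crossing over a minimum or maximum at the beginning of a word. -/
def slide : List Letter → Option (List Letter)
  | ⟨i, .min d⟩ :: ⟨j, .cross s⟩ :: w =>
    if j = i + 1 ∨ i = j + 1 then some (⟨j, .min d⟩ :: ⟨i, .cross (!s)⟩ :: w) else none
  | ⟨i, .cross s⟩ :: ⟨j, .max d⟩ :: w =>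
    if j = i + 1 ∨ i = j + 1 then some (⟨j, .cross (!s)⟩ :: ⟨i, .max d⟩ :: w) else none
  | _ => none

theorem diagramStep_of_slide {u v : List Letter} (h : slide u = some v) : DiagramStep u v := by
  unfold slide at h
  split at h <;> (try split_ifs at h with hc) <;> cases h
  · rename_i i d j s w
    obtain rfl | rfl := hc
    · exact .isotopy (.slideMin i s d) w
    · have h := DiagramStep.isotopy (.slideMin j (!s) d) w
      rw [Bool.not_not] at h
      exact h.symm
  · rename_i i s j d w
    obtain rfl | rfl := hc
    · have h := DiagramStep.isotopy (.slideMax i (!s) d) w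
      rw [Bool.not_not] at h
      exact h.symm
    · exact .isotopy (.slideMax j s d) w

/-- Perform a third Reidemeister move at the beginning of a word. -/
def triangle : List Letter → Option (List Letter)
  | ⟨i, .cross a⟩ :: ⟨j, .cross b⟩ :: ⟨k, .cross c⟩ :: w =>
    if k = i ∧ (j = i + 1 ∨ i = j + 1) ∧ (a = c → b = a) then
      some (⟨j, .cross c⟩ :: ⟨i, .cross b⟩ :: ⟨j, .cross a⟩ :: w)
    else none
  | _ => none

theorem diagramStep_of_triangle {u v : List Letter} (h : triangle u = some v) :
    DiagramStep u v := by
  unfold triangle at h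
  split at h <;> (try split_ifs at h with hc) <;> cases h
  rename_i i a j b k c w
  obtain ⟨rfl, rfl | rfl, h⟩ := hc
  · exact .reidemeister (.r3 _ a b c h) w
  -- The move is read backwards, which exchanges the roles of `a` and `c` in its hypothesis.
  · exact (DiagramStep.reidemeister (.r3 j c b a fun h' => h' ▸ h h'.symm) w).symm

/-- A move at the beginning of a word. -/
def headMove (kind arg : ℕ) (w : List Letter) : Option (List Letter) :=
  match kind with
  | 0 => exchange w
  | 2 => simplify w
  -- Creates a cancelling pair of crossings: the last bit of `arg` is the type of the lower one, the
  -- remaining bits are the position.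
  | 3 => some (⟨arg / 2, .cross (arg % 2 == 1)⟩ :: ⟨arg / 2, .cross (!(arg % 2 == 1))⟩ :: w)
  | 5 => insertKink (arg == 1) w
  | 6 => slide w
  | 7 => triangle w
  | _ => none

theorem diagramStep_of_headMove {kind arg : ℕ} {u v : List Letter}
    (h : headMove kind arg u = some v) : DiagramStep u v := by
  unfold headMove at h
  split at h
  · exact diagramStep_of_exchange h
  · exact diagramStep_of_simplify h
  · cases h
    exact (DiagramStep.reidemeister (.r2 _ _) u).symm
  · exact diagramStep_of_insertKink h
  · exact diagramStep_of_slide h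
  · exact diagramStep_of_triangle h
  · cases h

/-- A move after the first `p` events of a word. -/
def moveAt (kind arg : ℕ) : ℕ → List Letter → Option (List Letter)
  | 0, w => headMove kind arg w
  | p + 1, l :: w => (moveAt kind arg p w).map (l :: ·)
  | _ + 1, [] => none

theorem diagramStep_of_moveAt {kind arg p : ℕ} {u v : List Letter}
    (h : moveAt kind arg p u = some v) : DiagramStep u v := by
  induction p generalizing u v with
  | zero => exact diagramStep_of_headMove h
  | succ p ih =>
    cases u with
    | nil => cases h
    | cons l u =>
      simp only [moveAt, Option.map_eq_some_iff] at h
      obtain ⟨w, hw, rfl⟩ := h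
      exact (ih hw).append_left [l]

/-- A move that leads to a diagram. -/
def closedMoveAt (kind arg p : ℕ) (w : List Letter) : Option (List Letter) :=
  (moveAt kind arg p w).filter fun v => run v [] == some []

/-- The moves encoded by a number: its residue modulo 8 is the kind of the move, where 0 and 1 stand
for sequences of exchanges that take an event up or down, the next six binary digits are the place,
and the others an argument. -/
def codedMove (c : ℕ) (w : List Letter) : Option (List Letter) :=
  match c % 8 with
  | 0 => (List.range (c / 512)).foldlM (fun w k => closedMoveAt 0 0 (c / 8 % 64 + k) w) w
  | 1 => (List.range (c / 512)).foldrM (fun k w => closedMoveAt 0 0 (c / 8 % 64 + k) w) w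
  | kind => closedMoveAt kind (c / 512) (c / 8 % 64) w

def codedMoves (l : List ℕ) (w : List Letter) : Option (List Letter) :=
  l.foldlM (fun w c => codedMove c w) w

/-- A word represents a diagram that is Reidemeister equivalent to a given one. -/
def ReachableFrom (D : Diagram) (w : List Letter) : Prop :=
  ∃ E : Diagram, E.word = w ∧ ReidemeisterEquivalent D E

theorem ReachableFrom.closedMoveAt {D : Diagram} {u v : List Letter} (hu : ReachableFrom D u)
    {kind arg p : ℕ} (h : closedMoveAt kind arg p u = some v) : ReachableFrom D v := by
  obtain ⟨E, rfl, hE⟩ := hu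
  simp only [SymUnion.closedMoveAt, Option.filter_eq_some_iff, beq_iff_eq] at h
  refine ⟨⟨v, h.2⟩, rfl, hE.trans _ _ _ ?_⟩
  exact (diagramStep_of_moveAt h.1).elim (fun h => .rel _ _ h) fun h => .symm _ _ (.rel _ _ h)

theorem ReachableFrom.foldlM {α : Type} {D : Diagram} {f : List Letter → α → Option (List Letter)}
    (hf : ∀ u v a, ReachableFrom D u → f u a = some v → ReachableFrom D v) (l : List α)
    {u v : List Letter} (hu : ReachableFrom D u) (h : l.foldlM f u = some v) :
    ReachableFrom D v := by
  induction l generalizing u with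
  | nil => cases h; exact hu
  | cons a l ih =>
    rw [List.foldlM_cons] at h
    obtain ⟨w, hw, h⟩ := Option.bind_eq_some_iff.1 h
    exact ih (hf _ _ _ hu hw) h

theorem ReachableFrom.codedMove {D : Diagram} {u v : List Letter} (hu : ReachableFrom D u) {c : ℕ}
    (h : codedMove c u = some v) : ReachableFrom D v := by
  unfold SymUnion.codedMove at h
  split at h
  · exact ReachableFrom.foldlM (fun _ _ _ hu h => hu.closedMoveAt h) _ hu h
  · rw [← List.foldlM_reverse] at h
    exact ReachableFrom.foldlM (fun _ _ _ hu h => hu.closedMoveAt h) _ hu h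
  · exact hu.closedMoveAt h

theorem ReachableFrom.codedMoves {D : Diagram} {u v : List Letter} (hu : ReachableFrom D u)
    {l : List ℕ} (h : codedMoves l u = some v) : ReachableFrom D v :=
  ReachableFrom.foldlM (fun _ _ _ hu h => hu.codedMove h) l hu h

/-- Both diagrams are taken to one common word. Requiring `isSome` excludes that two failing
sequences agree as `none`. -/
theorem reidemeisterEquivalent_of_codedMoves {D E : Diagram} (k l : List ℕ)
    (h : (codedMoves k D.word).isSome && codedMoves k D.word == codedMoves l E.word) :
    ReidemeisterEquivalent D E := by
  simp only [Bool.and_eq_true, beq_iff_eq, Option.isSome_iff_exists] at h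
  obtain ⟨⟨w, hw⟩, h⟩ := h
  rw [hw] at h
  obtain ⟨D', hD', h1⟩ := ReachableFrom.codedMoves ⟨D, rfl, .refl _⟩ hw
  obtain ⟨E', hE', h2⟩ := ReachableFrom.codedMoves ⟨E, rfl, .refl _⟩ h.symm
  obtain ⟨_, _⟩ := D'
  obtain ⟨_, _⟩ := E'
  cases hD'
  cases hE'
  exact h1.trans _ _ _ h2.symm

/-- Moves on `D₄` and on `D'₄` that lead to the same diagram, for equal names of the
orientations. -/
def movesD4 : List ℕ :=
  [672, 520, 4123, 22, 520, 2075, 22, 520, 617, 95, 79, 111, 122, 119, 640, 665, 143, 1688, 178,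
   547, 553, 1587, 2064, 512, 14, 18, 14, 18, 1049, 2595, 1577, 3635, 520, 22, 26, 22, 26, 1065,
   1585, 520, 22, 26, 22, 26, 553, 1075, 2064, 512, 14, 18, 14, 18, 2155, 4723, 3195, 158, 648, 146,
   142, 130, 640, 616, 4723, 3707, 672, 158, 146, 142, 130, 1632, 1624, 2675, 1147, 2177, 166, 656,
   154, 150, 138, 648, 1608, 103, 123, 2691, 1163, 2193, 182, 672, 170, 166, 154, 664, 633, 111,
   2691, 1675, 2193, 696, 182, 170, 166, 154, 119, 3136, 641, 119, 3632, 111, 4227, 3211, 688, 174,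
   162, 158, 146, 632, 3195, 158, 648, 146, 142, 130, 640, 625, 103, 547, 2603, 1587, 2064, 512, 14,
   18, 14, 18, 547, 553, 1587, 2064, 14, 537, 18, 14, 18, 512, 5168, 1659, 2177, 166, 656, 154, 150,
   138, 648, 1561, 2083, 4651, 3635, 520, 22, 26, 22, 26, 2080, 71, 1577, 31, 529, 10, 2595, 2601,
   3123, 520, 22, 26, 22, 26, 3648, 2171, 1667, 2185, 174, 664, 162, 158, 146, 656, 4152, 2171,
   1667, 2185, 174, 664, 162, 158, 146, 656, 525, 528, 31, 39, 569, 50, 2083, 4651, 3635, 520, 22,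
   26, 22, 26, 544, 1081, 47, 31, 529, 10, 2595, 1065, 3123, 520, 22, 26, 22, 26, 525, 528, 31, 39,
   50, 653, 641, 119, 111, 1592, 609, 87, 103, 601, 79, 560, 63, 552, 55, 39, 31, 18, 1057, 4651,
   3635, 520, 22, 26, 22, 26]

def movesD4' : List ℕ :=
  [656, 520, 512, 577, 55, 544, 47, 71, 82, 63, 584, 609, 87, 1120, 114, 2595, 4139, 3635, 22, 545,
   26, 22, 26, 520, 47, 31, 18, 545, 4651, 3123, 22, 545, 26, 22, 26, 520, 533, 31, 39, 50, 552,
   1089, 55, 2595, 4139, 3635, 22, 545, 26, 22, 26, 520, 525, 528, 553, 31, 47, 577, 55, 585, 66,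
   2595, 1065, 3635, 22, 545, 26, 22, 26, 520, 2595, 1577, 3635, 22, 545, 26, 22, 26, 520, 115,
   2683, 1667, 2185, 688, 174, 162, 158, 146, 13, 528, 31, 39, 47, 58, 569, 47, 2595, 4139, 3635,
   22, 545, 26, 22, 26, 520, 47, 31, 18, 545, 4651, 3123, 22, 545, 26, 22, 26, 520, 669, 1161, 624,
   127, 616, 119, 600, 103, 87, 585, 63, 79, 609, 90, 635, 2179, 1163, 2193, 696, 182, 170, 166,
   154, 608, 633, 111, 127, 1160, 154, 131, 1136, 1667, 2185, 688, 174, 162, 158, 146, 669, 1161,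
   127, 111, 122, 533, 31, 39, 50, 2595, 4139, 3635, 22, 545, 26, 22, 26, 520, 569, 47, 31, 18, 545,
   4651, 3123, 22, 545, 26, 22, 26, 520, 3097, 4129, 2603, 1587, 2064, 512, 14, 18, 14, 18, 4641,
   1587, 2064, 14, 537, 18, 14, 18, 512, 537, 2595, 1065, 3123, 520, 22, 26, 22, 26, 2595, 1577,
   3123, 520, 22, 26, 22, 26, 525, 528, 31, 39, 569, 50, 2083, 4651, 3635, 520, 22, 26, 22, 26, 544,
   1081, 47, 31, 529, 10, 2595, 1065, 3123, 520, 22, 26, 22, 26, 525, 528, 31, 39, 50, 2083, 4651,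
   3635, 520, 22, 26, 22, 26, 533, 31, 47, 545, 4651, 3635, 520, 22, 26, 22, 26, 2083, 4651, 3635,
   520, 22, 26, 22, 26, 1064, 63, 71, 79, 609, 90]

/-- Moves on `D₄` and on `D'₄` that lead to the same diagram, for different names of the
orientations. -/
def twistedMovesD4 : List ℕ :=
  [672, 520, 4123, 22, 520, 2075, 22, 520, 617, 95, 79, 111, 122, 119, 640, 665, 143, 1688, 178,
   2081, 1075, 2064, 14, 537, 18, 14, 18, 512, 537, 2595, 1065, 3635, 520, 22, 26, 22, 26, 553, 561,
   520, 22, 26, 22, 26, 2155, 4723, 3195, 158, 648, 146, 142, 130, 640, 1096, 95, 576, 79, 1128,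
   1624, 2675, 1659, 2177, 680, 166, 154, 150, 138, 600, 103, 624, 2683, 4739, 3723, 688, 174, 162,
   158, 146, 1641, 95, 1097, 63, 1105, 74, 552, 55, 1561, 18, 95, 592, 617, 95, 35, 2603, 1075,
   2064, 14, 537, 18, 14, 18, 512, 552, 1089, 55, 643, 632, 1155, 2185, 688, 174, 162, 158, 146,
   525, 528, 31, 39, 50, 553, 1089, 1097, 2129, 625]

def twistedMovesD4' : List ℕ :=
  [656, 520, 512, 577, 55, 544, 47, 71, 82, 63, 584, 609, 87, 1120, 114, 2595, 4139, 3635, 22, 545,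
   26, 22, 26, 520, 47, 31, 18, 545, 4651, 3123, 22, 545, 26, 22, 26, 520, 533, 31, 39, 50, 552,
   1089, 55, 2595, 4139, 3635, 22, 545, 26, 22, 26, 520, 525, 528, 553, 31, 47, 577, 55, 585, 66,
   2595, 1065, 3635, 22, 545, 26, 22, 26, 520, 2595, 1577, 3635, 22, 545, 26, 22, 26, 520, 115,
   2683, 1667, 2185, 688, 174, 162, 158, 146, 13, 528, 31, 39, 47, 58, 569, 47, 2595, 4139, 3635,
   22, 545, 26, 22, 26, 520, 47, 31, 18, 545, 4651, 3123, 22, 545, 26, 22, 26, 520, 669, 1161, 624,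
   127, 616, 119, 600, 103, 87, 585, 63, 79, 609, 90, 635, 2179, 1163, 2193, 696, 182, 170, 166,
   154, 608, 633, 111, 127, 1160, 154, 131, 1136, 1667, 2185, 688, 174, 162, 158, 146, 669, 1161,
   127, 111, 122, 533, 31, 39, 50, 2595, 4139, 3635, 22, 545, 26, 22, 26, 520, 569, 47, 31, 18, 545,
   4651, 3123, 22, 545, 26, 22, 26, 520, 3097, 4129, 2603, 1587, 2064, 512, 14, 18, 14, 18, 4641,
   1587, 2064, 14, 537, 18, 14, 18, 512, 537, 2595, 1065, 3123, 520, 22, 26, 22, 26, 2595, 1577,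
   3123, 520, 22, 26, 22, 26, 619, 2163, 1147, 2177, 680, 166, 154, 150, 138, 525, 528, 31, 39, 569,
   50, 2083, 4651, 3635, 520, 22, 26, 22, 26, 544, 1081, 47, 31, 529, 10, 2595, 1065, 3123, 520, 22,
   26, 22, 26, 525, 528, 31, 39, 50, 2083, 4651, 3635, 520, 22, 26, 22, 26, 2083, 553, 3123, 520,
   22, 26, 22, 26, 525, 528, 31, 39, 50, 2083, 4651, 3123, 22, 545, 26, 22, 26, 520, 47, 55, 63,
   593, 74, 149, 1153, 616, 119, 103, 87, 585, 63, 79, 609, 90, 2083, 4651, 3123, 22, 545, 26, 22,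
   26, 520, 131, 1136, 1667, 2185, 688, 174, 162, 158, 146, 533, 31, 561, 39, 55, 63, 74, 2595,
   4139, 3635, 22, 545, 26, 22, 26, 520, 569, 47, 31, 18, 545, 4651, 3123, 22, 545, 26, 22, 26, 520,
   533, 31, 39, 50, 2595, 4139, 3635, 22, 545, 26, 22, 26, 520, 1081, 47, 31, 18, 544, 47, 55, 66,
   4651, 3123, 22, 545, 26, 22, 26, 520, 3097, 4129, 2603, 1587, 2064, 512, 14, 18, 14, 18, 4641,
   2603, 1587, 2064, 512, 14, 18, 14, 18, 35, 2603, 1587, 2064, 512, 14, 18, 14, 18, 35, 553, 1075,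
   2064, 512, 14, 18, 14, 18, 5160, 2171, 1155, 2185, 688, 174, 162, 158, 146, 5664, 1139, 2169,
   158, 648, 146, 142, 130, 640, 616, 2163, 4219, 3203, 680, 166, 154, 150, 138, 103, 2179, 632,
   3203, 166, 656, 154, 150, 138, 648, 111, 1112, 633, 111, 643, 632, 1155, 2185, 688, 174, 162,
   158, 146, 1136, 2179, 3152, 3203, 166, 656, 154, 150, 138, 648, 608, 111, 2120, 633, 111, 2112,
   103, 643, 632, 1155, 2185, 688, 174, 162, 158, 146, 643, 1136, 1155, 2185, 688, 174, 162, 158,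
   146, 1640, 2179, 4664, 3203, 166, 656, 154, 150, 138, 648, 4731, 3715, 680, 166, 154, 150, 138,
   1136, 1128, 2683, 1155, 2185, 174, 664, 162, 158, 146, 656, 1112, 111, 2608, 95, 4121, 18, 525,
   528, 31, 39, 50, 547, 2091, 1587, 2064, 14, 537, 18, 14, 18, 512, 13, 528, 31, 47, 544, 569, 47,
   63, 74, 2603, 1075, 2064, 14, 537, 18, 14, 18, 512, 35, 2603, 1075, 2064, 14, 537, 18, 14, 18,
   512, 552, 577, 55, 71, 569, 47, 31, 42, 529, 10, 547, 2091, 1587, 2064, 14, 537, 18, 14, 18, 512,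
   47, 31, 529, 10, 545, 2603, 1075, 2064, 14, 537, 18, 14, 18, 512, 525, 528, 31, 39, 50, 547,
   2091, 1587, 2064, 14, 537, 18, 14, 18, 512, 545, 2091, 1075, 2064, 512, 14, 18, 14, 18, 525, 528,
   31, 39, 50, 547, 2091, 1075, 2064, 512, 14, 18, 14, 18, 544, 47, 55, 66, 133, 633, 608, 111, 95,
   593, 71, 55, 66, 547, 2091, 1075, 2064, 512, 14, 18, 14, 18, 1056, 55, 517, 1032, 31, 39, 50,
   609, 625]

theorem reidemeisterEquivalent_D4_D4' (d d' : Bool) :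
    ReidemeisterEquivalent (D4 d).toDiagram (D4' d').toDiagram := by
  by_cases h : d' = d
  · subst h
    refine reidemeisterEquivalent_of_codedMoves movesD4 movesD4' ?_
    cases d' <;> decide +kernel
  -- With one orientation reversed, a longer detour to a different common diagram is needed; each
  -- pair of move lists serves both values of `d`.
  · obtain rfl : d' = !d := by cases d <;> cases d' <;> simp_all
    refine reidemeisterEquivalent_of_codedMoves twistedMovesD4 twistedMovesD4' ?_
    cases d <;> decide +kernel

end SymUnion

theorem theorem1p2 (d d' : Bool) :
    (SymUnion.D4 d).IsSymmetricUnion ∧ (SymUnion.D4' d').IsSymmetricUnion ∧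
      SymUnion.ReidemeisterEquivalent (SymUnion.D4 d).toDiagram (SymUnion.D4' d').toDiagram ∧
      ¬ SymUnion.WeaklySymmetricallyEquivalent (SymUnion.D4 d) (SymUnion.D4' d') := by
  exact ⟨SymUnion.isSymmetricUnion_D4 d, SymUnion.isSymmetricUnion_D4' d',
    SymUnion.reidemeisterEquivalent_D4_D4' d d',
    SymUnion.not_weaklySymmetricallyEquivalent_D4_D4' d d'⟩
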